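/- Let $(R,\mathfrak m)$ be a Noetherian local ring of dimension $d$. A parameter ideal of $R$ is an ideal generated by a system of parameters, i.e. by $d$ elements $x_1,\dots,x_d$ such that $(x_1,\dots,x_d)$ is $\mathfrak m$-primary. For an $\mathfrak m$-primary ideal $I$, the Hilbert coefficients $e_0(I),\dots,e_d(I)\in\mathbb Z$ are determined by $$\ell(R/I^{n+1})=\sum_{i=0}^{d}(-1)^i e_i(I)\binom{n+d-i}{d-i}\qquad\text{for all } n\gg 0,$$ where $\ell$ denotes length (and $e_1(I)=0$ if $d=0$). The limit closure of a parameter ideal $Q=(x_1,\dots,x_d)$ is $$Q^{\lim}=\bigcup_{n\ge 0}\bigl((x_1^{n+1},\dots,x_d^{n+1}):_R (x_1\cdots x_d)^n\bigr),$$ which does not depend on the choice of the generators $x_1,\dots,x_d$ of $Q$. The ring $R$ is called Buchsbaum if $\ell(R/Q)-e_0(Q)$ has the same value for all parameter ideals $Q$ of $R$, and it satisfies $(S_2)$ if $\operatorname{depth}R_{\mathfrak p}\ge\min\{2,\dim R_{\mathfrak p}\}$ for every prime ideal $\mathfrak p$ of $R$. Suppose that $R$ is Buchsbaum and satisfies $(S_2)$.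 Then for every parameter ideal $Q$ of $R$ $$e_0(Q)-\ell(R/Q^{\lim})+e_1(Q)\ge 0.$$ Moreover, if equality holds for some parameter ideal $Q$ of $R$, then $R$ is Cohen–Macaulay. -/

import Mathlib

noncomputable section

universe u

/-- The length of an `R`-module as an integer. It is only used for quotients of a Noetherian local
ring by ideals containing a power of a parameter ideal, where the length is finite. -/
def lengthInt (R : Type u) [CommRing R] (M : Type u) [AddCommGroup M] [Module R M] : ℤ :=
  ((Module.length R M).toNat : ℤ)

/-- `x₁, …, x_d` is a system of parameters of the local ring `R`: `d = dim R` and the ideal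
`(x₁, …, x_d)` is primary to the maximal ideal. -/
def IsSystemOfParameters {R : Type u} [CommRing R] [IsLocalRing R] {d : ℕ} (x : Fin d → R) :
    Prop :=
  ringKrullDim R = (d : WithBot ℕ∞) ∧
    (Ideal.span (Set.range x)).radical = IsLocalRing.maximalIdeal R

/-- A parameter ideal is an ideal generated by a system of parameters. -/
def IsParameterIdeal {R : Type u} [CommRing R] [IsLocalRing R] (Q : Ideal R) : Prop :=
  ∃ (d : ℕ) (x : Fin d → R), IsSystemOfParameters x ∧ Q = Ideal.span (Set.range x)

/-- `e₀, …, e_d` (continued by zero) are the Hilbert coefficients of `I`, where `d = dim R`: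
`ℓ(R/I^{n+1}) = ∑ᵢ (-1)^i eᵢ C(n+d-i, d-i)` for all large `n`. -/
def IsHilbertCoeffs {R : Type u} [CommRing R] (I : Ideal R) (e : ℕ → ℤ) : Prop :=
  ∃ d : ℕ, ringKrullDim R = (d : WithBot ℕ∞) ∧ (∀ i, d < i → e i = 0) ∧
    ∀ᶠ n : ℕ in Filter.atTop,
      lengthInt R (R ⧸ I ^ (n + 1)) =
        ∑ i ∈ Finset.range (d + 1), (-1) ^ i * e i * ((n + d - i).choose (d - i) : ℤ)

open Classical in
/-- The Hilbert coefficient `eᵢ(I)`. For an ideal `I` primary to the maximal ideal of a Noetherian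
local ring, a sequence as in `IsHilbertCoeffs` exists and is unique; where none exists, the value
is `0`. -/
def hilbertCoeff {R : Type u} [CommRing R] (I : Ideal R) (i : ℕ) : ℤ :=
  if h : ∃ e : ℕ → ℤ, IsHilbertCoeffs I e then h.choose i else 0

/-- A local ring is Buchsbaum if `ℓ(R/Q) - e₀(Q)` is the same for all parameter ideals `Q`. -/
def IsBuchsbaum (R : Type u) [CommRing R] [IsLocalRing R] : Prop :=
  ∃ c : ℤ, ∀ Q : Ideal R, IsParameterIdeal Q → lengthInt R (R ⧸ Q) - hilbertCoeff Q 0 = c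

/-- The depth of a local ring: the supremum of the lengths of the regular sequences contained in
the maximal ideal. -/
def localDepth (R : Type u) [CommRing R] [IsLocalRing R] : ℕ∞ :=
  ⨆ rs ∈ {rs : List R | (∀ r ∈ rs, r ∈ IsLocalRing.maximalIdeal R) ∧
    RingTheory.Sequence.IsRegular R rs}, (rs.length : ℕ∞)

/-- Serre's condition `(S_k)`: `depth R_p ≥ min (k, dim R_p)` for every prime `p`. -/
def SatisfiesSerreS (R : Type u) [CommRing R] (k : ℕ) : Prop :=
  ∀ (p : Ideal R) [p.IsPrime],
    min (k : WithBot ℕ∞) (ringKrullDim (Localization.AtPrime p)) ≤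
      (localDepth (Localization.AtPrime p) : WithBot ℕ∞)

/-- A local ring is Cohen–Macaulay if its depth equals its dimension. -/
def IsCohenMacaulayLocal (R : Type u) [CommRing R] [IsLocalRing R] : Prop :=
  (localDepth R : WithBot ℕ∞) = ringKrullDim R

theorem limitClosure_step {R : Type u} [CommRing R] {d : ℕ} (x : Fin d → R) {a : R} {n : ℕ}
    (h : a * (∏ i, x i) ^ n ∈ Ideal.span (Set.range fun i => x i ^ (n + 1))) :
    a * (∏ i, x i) ^ (n + 1) ∈ Ideal.span (Set.range fun i => x i ^ (n + 1 + 1)) := by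
  rw [pow_succ, ← mul_assoc]
  refine Submodule.span_induction
    (p := fun b _ => b * ∏ i, x i ∈ Ideal.span (Set.range fun i => x i ^ (n + 1 + 1)))
    ?_ ?_ ?_ ?_ h
  · rintro _ ⟨i, rfl⟩
    obtain ⟨c, hc⟩ := Finset.dvd_prod_of_mem x (Finset.mem_univ i)
    rw [hc, show x i ^ (n + 1) * (x i * c) = c * x i ^ (n + 1 + 1) by ring]
    exact Ideal.mul_mem_left _ _ (Ideal.subset_span ⟨i, rfl⟩)
  · simp
  · intro b c _ _ hb hc
    rw [add_mul]
    exact add_mem hb hc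
  · intro r b _ hb
    rw [smul_eq_mul, mul_assoc]
    exact Ideal.mul_mem_left _ _ hb

theorem limitClosure_mono {R : Type u} [CommRing R] {d : ℕ} (x : Fin d → R) {a : R} {m n : ℕ}
    (hmn : m ≤ n) (h : a * (∏ i, x i) ^ m ∈ Ideal.span (Set.range fun i => x i ^ (m + 1))) :
    a * (∏ i, x i) ^ n ∈ Ideal.span (Set.range fun i => x i ^ (n + 1)) := by
  induction n, hmn using Nat.le_induction with
  | base => exact h
  | succ n _ ih => exact limitClosure_step x ih

/-- The limit closure of `Q = (x₁, …, x_d)`: the union over `n ≥ 0` of the ideals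
`(x₁^{n+1}, …, x_d^{n+1}) : (x₁ ⋯ x_d)^n`. -/
def limitClosure {R : Type u} [CommRing R] {d : ℕ} (x : Fin d → R) : Ideal R where
  carrier := {a | ∃ n : ℕ, a * (∏ i, x i) ^ n ∈ Ideal.span (Set.range fun i => x i ^ (n + 1))}
  zero_mem' := ⟨0, by simp⟩
  add_mem' := by
    rintro a b ⟨m, hm⟩ ⟨n, hn⟩
    refine ⟨max m n, ?_⟩
    rw [add_mul]
    exact add_mem (limitClosure_mono x (le_max_left m n) hm)
      (limitClosure_mono x (le_max_right m n) hn)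
  smul_mem' := by
    rintro c a ⟨n, hn⟩
    refine ⟨n, ?_⟩
    rw [smul_eq_mul, mul_assoc]
    exact Ideal.mul_mem_left _ _ hn

end

/-!
For a family `x` of `d ≥ 2` parameters generating `Q`, the lexicographic filtration of `R / Q^{n+1}`
by monomials of degree at most `n` has as successive quotients the rings `R / I_α`, where `I_α` is
the ideal of leading coefficients at `x^α`. It contains `((x_{i+1}, …, x_d) : x_i) + Q` whenever
`α_i > 0`. Comparing with the Hilbert polynomial gives
`e₁(Q) ≥ e₀(Q) - ℓ(R / ((x_3, …, x_d) : x_2 + Q))`, provided that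
`ℓ(R / ((x_2, …, x_d) : x_1 + Q)) = e₀(Q)`.

Since `e₀` is multiplicative in powers of the parameters, constancy of `ℓ(R/Q) - e₀(Q)` makes the
ideals `(x_j)_{j ∈ J} : x_i^n` independent of `n` and gives
`((x_j)_{j ∈ J} : x_i) ∩ Q = (x_j)_{j ∈ J}`. It follows that `C_i = ((x_j)_{j ≠ i} : x_i) + Q` has
colength `e₀(Q)` and that `e₀(Q) + e₁(Q) ≥ ℓ(R / (C_i + C_j)) ≥ ℓ(R / Q^lim)`, because
`C_i ⊆ Q^lim`.

Equality forces `Q^lim = C_i + C_j` for all `i ≠ j`. If `a x_i ∈ (x_j)_{j ∈ J}` then `a ∈ Q^lim`, so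
`a ∏_{j ∈ J} x_j` lies in the ideal obtained from `Q` by squaring the `x_j` with `j ∈ J`; it is also
killed by `x_i` modulo the squares alone, hence lies in the ideal they generate. Cancelling the
product by induction on `|J|` shows that `x` is a regular sequence; depth at least `2` starts the
induction at `|J| ≤ 1`.
-/

/-! ### Lengths of quotients by ideals -/

section Length

variable {R : Type*} [CommRing R]

theorem mem_colon_singleton_iff_mul_mem {I : Ideal R} {a b : R} :
    a ∈ I.colon {b} ↔ a * b ∈ I := by
  rw [Submodule.mem_colon_singleton, smul_eq_mul]

/-- The length of `R ⧸ I` as an integer; it is `0` if that length is infinite. -/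
noncomputable abbrev colength (I : Ideal R) : ℤ := lengthInt R (R ⧸ I)

theorem isFiniteLength_quotient_of_le {I J : Ideal R} (hI : IsFiniteLength R (R ⧸ I))
    (hIJ : I ≤ J) : IsFiniteLength R (R ⧸ J) :=
  hI.of_surjective (Submodule.factor_surjective hIJ)

theorem colength_top : colength (⊤ : Ideal R) = 0 := by
  have : Subsingleton (R ⧸ (⊤ : Ideal R)) := Ideal.Quotient.subsingleton_iff.mpr rfl
  simp [lengthInt, Module.length_eq_zero]

theorem colength_mono {I J : Ideal R} (hI : IsFiniteLength R (R ⧸ I)) (hIJ : I ≤ J) :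
    colength J ≤ colength I :=
  Int.ofNat_le.mpr <| ENat.toNat_le_toNat
    (Module.length_le_of_surjective (Submodule.factor hIJ) (Submodule.factor_surjective hIJ))
    (Module.length_ne_top_iff.mpr hI)

theorem eq_of_le_of_colength_le {I J : Ideal R} (hI : IsFiniteLength R (R ⧸ I)) (hIJ : I ≤ J)
    (h : colength I ≤ colength J) : I = J := by
  by_contra hne
  have hI_top := Module.length_ne_top_iff.mpr hI
  have hJ_top := Module.length_ne_top_iff.mpr (isFiniteLength_quotient_of_le hI hIJ)
  have hlt : Module.length R (R ⧸ J) < Module.length R (R ⧸ I) := by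
    rw [Module.length_quotient] at hJ_top ⊢
    rw [Module.length_quotient]
    exact Order.coheight_strictAnti (lt_of_le_of_ne hIJ hne) hJ_top.lt_top
  rw [← ENat.natCast_toNat hI_top, ← ENat.natCast_toNat hJ_top, Nat.cast_lt] at hlt
  exact hlt.not_ge (Int.ofNat_le.mp h)

theorem length_quotient_eq_add_comap {M P : Type*} [AddCommGroup M] [Module R M] [AddCommGroup P]
    [Module R P] (N : Submodule R M) (f : P →ₗ[R] M) :
    Module.length R (M ⧸ N) =
      Module.length R (P ⧸ N.comap f) + Module.length R (M ⧸ (N ⊔ LinearMap.range f)) := by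
  refine Module.length_eq_add_of_exact ((N.comap f).mapQ N f le_rfl)
    (Submodule.factor le_sup_left) ?_ (Submodule.factor_surjective _) ?_
  · rw [← LinearMap.ker_eq_bot, Submodule.ker_mapQ, Submodule.mkQ_map_self]
  · rw [LinearMap.exact_iff, Submodule.factor, Submodule.ker_mapQ, Submodule.range_mapQ,
      Submodule.comap_id, Submodule.map_sup, Submodule.mkQ_map_self, bot_sup_eq]

theorem length_quotient_inf_add_length_quotient_sup {M : Type*} [AddCommGroup M] [Module R M]
    (I J : Submodule R M) :
    Module.length R (M ⧸ (I ⊓ J)) + Module.length R (M ⧸ (I ⊔ J)) =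
      Module.length R (M ⧸ I) + Module.length R (M ⧸ J) := by
  have hinf := length_quotient_eq_add_comap (I ⊓ J) I.subtype
  have hJ := length_quotient_eq_add_comap J I.subtype
  rw [Submodule.comap_inf, Submodule.comap_subtype_self, top_inf_eq, Submodule.range_subtype,
    sup_eq_right.mpr inf_le_left] at hinf
  rw [Submodule.range_subtype, sup_comm] at hJ
  rw [hinf, hJ, add_right_comm, add_comm (Module.length R (M ⧸ I)), add_right_comm]

theorem colength_eq_add_colon {I : Ideal R} (hI : IsFiniteLength R (R ⧸ I)) (r : R) :
    colength I = colength (I ⊔ Ideal.span {r}) + colength (I.colon {r}) := by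
  have hcolon : I.colon {r} = Submodule.comap (LinearMap.toSpanSingleton R R r) I := by
    ext a
    rw [Submodule.mem_colon_singleton, Submodule.mem_comap, LinearMap.toSpanSingleton_apply]
  have hadd : Module.length R (R ⧸ I) =
      Module.length R (R ⧸ I.colon {r}) + Module.length R (R ⧸ (I ⊔ Ideal.span {r})) := by
    rw [hcolon, Ideal.span, ← LinearMap.range_toSpanSingleton (R := R)]
    exact length_quotient_eq_add_comap (M := R) (P := R) I _
  rw [colength, lengthInt, hadd, ENat.toNat_add
    (Module.length_ne_top_iff.mpr (isFiniteLength_quotient_of_le hI Ideal.le_colon))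
    (Module.length_ne_top_iff.mpr (isFiniteLength_quotient_of_le hI le_sup_left)), add_comm]
  exact Nat.cast_add _ _

theorem colength_inf_add_colength_sup {I J : Ideal R} (h : IsFiniteLength R (R ⧸ (I ⊓ J))) :
    colength (I ⊓ J) + colength (I ⊔ J) = colength I + colength J := by
  have hI := isFiniteLength_quotient_of_le h inf_le_left
  have hJ := isFiniteLength_quotient_of_le h inf_le_right
  have hsup := isFiniteLength_quotient_of_le hI (le_sup_left (b := J))
  have key := congrArg ENat.toNat (length_quotient_inf_add_length_quotient_sup (R := R) I J)
  rw [← Module.length_ne_top_iff] at h hI hJ hsup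
  rw [ENat.toNat_add h hsup, ENat.toNat_add hI hJ] at key
  simp only [colength, lengthInt]
  exact_mod_cast key

theorem colength_eq_sum_colon {ι κ : Type*} [LinearOrder κ] {key : ι → κ}
    (hkey : Function.Injective key) (m : ι → R) {I : Ideal R} (hI : IsFiniteLength R (R ⧸ I))
    (s : Finset ι) :
    colength I = colength (I ⊔ Ideal.span (m '' s)) +
      ∑ i ∈ s, colength ((I ⊔ Ideal.span (m '' {j | j ∈ s ∧ key j < key i})).colon {m i}) := by
  classical
  induction s using Finset.induction_on_max_value key with
  | empty => simp
  | insert a s ha hle ih =>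
    have hlt : ∀ j ∈ s, key j < key a := fun j hj =>
      lt_of_le_of_ne (hle j hj) fun h => ha (hkey h ▸ hj)
    have hlt_a : {j | j ∈ insert a s ∧ key j < key a} = (s : Set ι) := by
      ext j
      have := hlt j
      grind
    have hlt_of_mem : ∀ i ∈ s, {j | j ∈ insert a s ∧ key j < key i} =
        {j | j ∈ s ∧ key j < key i} := by
      intro i hi
      ext j
      have := hlt i hi
      grind
    rw [Finset.sum_insert ha, hlt_a,
      Finset.sum_congr rfl fun i hi => by rw [hlt_of_mem i hi], Finset.coe_insert,
      Set.image_insert_eq, Ideal.span_insert, sup_comm (Ideal.span {m a}), ← sup_assoc,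
      ← add_assoc,
      ← colength_eq_add_colon (isFiniteLength_quotient_of_le hI le_sup_left) (m a)]
    exact ih

theorem isFiniteLength_quotient_of_pow_le [IsLocalRing R] [IsNoetherianRing R] {I : Ideal R}
    {n : ℕ} (h : IsLocalRing.maximalIdeal R ^ n ≤ I) : IsFiniteLength R (R ⧸ I) := by
  by_cases hI : I = ⊤
  · have : Subsingleton (R ⧸ I) := Ideal.Quotient.subsingleton_iff.mpr hI
    exact .of_subsingleton
  have : IsArtinianRing (R ⧸ I) := by
    refine IsLocalRing.quotient_artinian_of_mem_minimalPrimes_of_isLocalRing _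
      ⟨⟨inferInstance, IsLocalRing.le_maximalIdeal hI⟩, fun p hp _ => ?_⟩
    have := hp.1
    exact hp.1.le_of_pow_le (h.trans hp.2)
  have : IsArtinian R (R ⧸ I) :=
    isArtinian_of_surjective_algebraMap (R := R ⧸ I) Ideal.Quotient.mk_surjective
  exact isFiniteLength_iff_isNoetherian_isArtinian.mpr ⟨inferInstance, this⟩

end Length

/-! ### Sums over simplices and eventually polynomial functions -/

section Combinatorics

open Filter Finset Asymptotics Topology

theorem sum_antidiagonalTuple_succ {M : Type*} [AddCommMonoid M] (d : ℕ)
    (g : (Fin (d + 1) → ℕ) → M) (m : ℕ) :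
    ∑ α ∈ Nat.antidiagonalTuple (d + 1) m, g α =
      ∑ k ∈ range (m + 1), ∑ β ∈ Nat.antidiagonalTuple d (m - k), g (Fin.cons k β) := by
  rw [Finset.sum_sigma']
  refine Finset.sum_bij' (fun α _ => ⟨α 0, Fin.tail α⟩) (fun p _ => Fin.cons p.1 p.2)
    (fun α hα => ?_) (fun p hp => ?_) (fun α _ => Fin.cons_self_tail α) (fun p _ => by simp)
    fun α _ => by rw [Fin.cons_self_tail]
  · rw [Nat.mem_antidiagonalTuple, Fin.sum_univ_succ] at hα
    simp only [mem_sigma, mem_range, Nat.mem_antidiagonalTuple, Fin.tail]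
    omega
  · simp only [mem_sigma, mem_range, Nat.mem_antidiagonalTuple] at hp
    simp only [Nat.mem_antidiagonalTuple, Fin.sum_univ_succ, Fin.cons_zero, Fin.cons_succ]
    omega

/-- The sum of `g α` over the lattice points `α` of the simplex `α₁ + ⋯ + α_d ≤ n`. -/
def simplexSum (d : ℕ) (g : (Fin d → ℕ) → ℤ) (n : ℕ) : ℤ :=
  ∑ m ∈ range (n + 1), ∑ α ∈ Nat.antidiagonalTuple d m, g α

theorem simplexSum_zero_left (g : (Fin 0 → ℕ) → ℤ) (n : ℕ) : simplexSum 0 g n = g ![] := by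
  rw [simplexSum, sum_range_succ']
  simp

theorem simplexSum_succ_left (d : ℕ) (g : (Fin (d + 1) → ℕ) → ℤ) (n : ℕ) :
    simplexSum (d + 1) g n =
      ∑ k ∈ range (n + 1), simplexSum d (fun β => g (Fin.cons k β)) (n - k) := by
  simp only [simplexSum, sum_antidiagonalTuple_succ]
  rw [sum_range_diag_flip (n + 1)
    (fun k j => ∑ β ∈ Nat.antidiagonalTuple d j, g (Fin.cons k β))]
  refine sum_congr rfl fun k hk => ?_
  rw [Nat.sub_add_comm (Nat.lt_succ_iff.mp (mem_range.mp hk))]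

theorem simplexSum_mono {d : ℕ} {g h : (Fin d → ℕ) → ℤ} (hgh : g ≤ h) (n : ℕ) :
    simplexSum d g n ≤ simplexSum d h n :=
  sum_le_sum fun _ _ => sum_le_sum fun _ _ => hgh _

theorem simplexSum_const (d : ℕ) (a : ℤ) (n : ℕ) :
    simplexSum d (fun _ => a) n = a * ((n + d).choose d : ℤ) := by
  induction d generalizing n with
  | zero => simp [simplexSum_zero_left]
  | succ d ih =>
    simp only [simplexSum_succ_left, ih]
    rw [← mul_sum, sum_flip fun k => ((k + d).choose d : ℤ), ← add_assoc,
      ← Nat.sum_range_add_choose, Nat.cast_sum]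

/-- `f` eventually agrees with a polynomial function of degree less than `d`, expressed by the
vanishing of its `d`-th difference. -/
def EventuallyPoly (d : ℕ) (f : ℕ → ℤ) : Prop := (fwdDiff 1)^[d] f =ᶠ[atTop] 0

namespace EventuallyPoly

variable {d : ℕ} {f g : ℕ → ℤ}

theorem comp_add_one_iff : EventuallyPoly d (fun n => f (n + 1)) ↔ EventuallyPoly d f := by
  unfold EventuallyPoly
  conv_rhs => rw [← map_add_atTop_eq_nat 1]
  simp only [EventuallyEq, eventually_map, fwdDiff_iter_comp_add, Pi.zero_apply]

theorem fwdDiff_iff : EventuallyPoly d (fwdDiff 1 f) ↔ EventuallyPoly (d + 1) f := Iff.rfl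

theorem add (hf : EventuallyPoly d f) (hg : EventuallyPoly d g) : EventuallyPoly d (f + g) := by
  rw [EventuallyPoly, fwdDiff_iter_add]
  simpa using EventuallyEq.add hf hg

theorem succ (hf : EventuallyPoly d f) : EventuallyPoly (d + 1) f := by
  rw [EventuallyPoly, Function.iterate_succ_apply']
  filter_upwards [hf, (tendsto_add_atTop_nat 1).eventually hf] with n hn hn'
  simp only [fwdDiff, hn', hn, Pi.zero_apply, sub_zero]

theorem convolution {s : ℕ → ℕ → ℤ} (hs : ∀ k, EventuallyPoly d (s k)) {K : ℕ}
    (hK : ∀ k, K ≤ k → s k = s K) :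
    EventuallyPoly (d + 1) fun n => ∑ k ∈ range (n + 1), s k (n - k) := by
  induction K generalizing s with
  | zero =>
    have hreflect : (fun n => ∑ k ∈ range (n + 1), s k (n - k)) =
        fun n => ∑ j ∈ range (n + 1), s 0 j := by
      funext n
      rw [← sum_flip (s 0)]
      exact sum_congr rfl fun k _ => by rw [hK k (Nat.zero_le k)]
    have hdiff : fwdDiff 1 (fun n => ∑ j ∈ range (n + 1), s 0 j) = fun n => s 0 (n + 1) :=
      funext fun n => by rw [fwdDiff, sum_range_succ _ (n + 1), add_sub_cancel_left]
    rw [hreflect, ← fwdDiff_iff, hdiff, comp_add_one_iff]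
    exact hs 0
  | succ K ih =>
    have hsplit : (fun n => ∑ k ∈ range (n + 1 + 1), s k (n + 1 - k)) =
        (fun n => ∑ k ∈ range (n + 1), s (k + 1) (n - k)) + fun n => s 0 (n + 1) := by
      funext n
      rw [sum_range_succ']
      simp
    rw [← comp_add_one_iff, hsplit]
    exact (ih (fun k => hs (k + 1)) fun k hk => hK (k + 1) (by omega)).add
      (comp_add_one_iff.mpr (hs 0)).succ

theorem exists_eventually_eq_const (hf : EventuallyPoly 1 f) : ∃ c, ∀ᶠ n in atTop, f n = c := by
  obtain ⟨N, hN⟩ := eventually_atTop.mp hf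
  refine ⟨f N, eventually_atTop.mpr ⟨N, fun n hn => ?_⟩⟩
  induction n, hn using Nat.le_induction with
  | base => rfl
  | succ n hn ih => rw [← ih, ← sub_eq_zero]; exact hN n hn

theorem exists_coeffs (hf : EventuallyPoly d f) :
    ∃ a : ℕ → ℤ, ∀ᶠ n in atTop, f n = ∑ j ∈ range d, a j * ((n + j).choose j : ℤ) := by
  induction d generalizing f with
  | zero => exact ⟨0, hf.mono fun n hn => by simpa using hn⟩
  | succ d ih =>
    obtain ⟨c, hc⟩ : ∃ c, ∀ᶠ n in atTop, (fwdDiff 1)^[d] f n = c :=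
      exists_eventually_eq_const <| by
        rwa [EventuallyPoly, ← Function.iterate_add_apply, add_comm]
    have hchoose : (fwdDiff 1)^[d] (fun n : ℕ => ((n + d).choose d : ℤ)) = 1 := by
      funext n
      rw [fwdDiff_iter_comp_add 1 (fun n : ℕ => (n.choose d : ℤ))]
      simpa using congrFun (fwdDiff_iter_choose 0 d) (n + d)
    have hsub : EventuallyPoly d (f + -c • fun n : ℕ => ((n + d).choose d : ℤ)) := by
      rw [EventuallyPoly, fwdDiff_iter_add, fwdDiff_iter_const_smul, hchoose]
      filter_upwards [hc] with n hn
      simp [hn]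
    obtain ⟨a, ha⟩ := ih hsub
    refine ⟨Function.update a d c, ?_⟩
    filter_upwards [ha] with n hn
    rw [sum_range_succ, Function.update_self, sum_congr rfl fun j hj => by
      rw [Function.update_of_ne (mem_range.mp hj).ne], ← hn]
    simp

end EventuallyPoly

theorem exists_stable_of_antitone {d : ℕ} {g : (Fin (d + 1) → ℕ) → ℕ} (hg : Antitone g) :
    ∃ K, ∀ k, K ≤ k → ∀ β : Fin d → ℕ, g (Fin.cons k β) = g (Fin.cons K β) := by
  let T : Set (Fin (d + 1) → ℕ) := ⋃ m ∈ Set.Iic (g 0), {α | Minimal (fun β => g β ≤ m) α}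
  -- Dickson's lemma: each of the sublevel sets has finitely many minimal elements.
  have hT : T.Finite := (Set.finite_Iic (g 0)).biUnion fun m _ =>
    WellQuasiOrderedLE.finite_of_isAntichain (setOfPred_minimal_antichain _)
  obtain ⟨K, hK⟩ := (hT.image fun α => α 0).bddAbove
  refine ⟨K, fun k hk β => le_antisymm (hg (Fin.cons_le_cons.mpr ⟨hk, le_rfl⟩)) ?_⟩
  obtain ⟨α, hα, hmin⟩ := (Set.isPWO_of_wellQuasiOrderedLE _).exists_le_minimal
    (show Fin.cons k β ∈ {α | g α ≤ g (Fin.cons k β)} from le_refl (g (Fin.cons k β)))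
  have hα0 : α 0 ≤ K := hK ⟨α, Set.mem_biUnion (hg fun i => Nat.zero_le _) hmin, rfl⟩
  exact (hg (Fin.le_cons.mpr ⟨hα0, fun j => hα j.succ⟩)).trans hmin.prop

theorem eventuallyPoly_simplexSum {d : ℕ} {g : (Fin d → ℕ) → ℕ} (hg : Antitone g) :
    EventuallyPoly (d + 1) (simplexSum d fun α => (g α : ℤ)) := by
  induction d with
  | zero =>
    rw [funext (simplexSum_zero_left _)]
    exact Eventually.of_forall fun n => sub_self _
  | succ d ih =>
    obtain ⟨K, hK⟩ := exists_stable_of_antitone hg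
    rw [funext (simplexSum_succ_left d _)]
    refine EventuallyPoly.convolution (fun k => ?_) (K := K) fun k hk => by simp only [hK k hk]
    exact ih (g := fun β => g (Fin.cons k β)) fun β γ h => hg (Fin.cons_le_cons.mpr ⟨le_rfl, h⟩)

theorem simplexSum_succ_left_le {d : ℕ} {g : (Fin (d + 1) → ℕ) → ℤ} {c : ℤ}
    (hc : ∀ α, 0 < α 0 → g α ≤ c) (n : ℕ) :
    simplexSum (d + 1) g n ≤
      c * (((n + (d + 1)).choose (d + 1) : ℤ) - ((n + d).choose d : ℤ)) +
        simplexSum d (fun β => g (Fin.cons 0 β)) n := by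
  rw [mul_sub, ← simplexSum_const, ← simplexSum_const, simplexSum_succ_left,
    simplexSum_succ_left, sum_range_succ', sum_range_succ', add_sub_assoc, Nat.sub_zero, sub_self,
    add_zero]
  exact add_le_add_left (sum_le_sum fun k _ => simplexSum_mono (fun β => hc _ (by simp)) _) _

theorem simplexSum_add_two_le {d : ℕ} {g : (Fin (d + 2) → ℕ) → ℤ} {a b c : ℤ} (ha : ∀ α, g α ≤ a)
    (hb : ∀ α, 0 < α 1 → g α ≤ b) (hc : ∀ α, 0 < α 0 → g α ≤ c) (n : ℕ) :
    simplexSum (d + 2) g n ≤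
      c * (((n + (d + 2)).choose (d + 2) : ℤ) - ((n + (d + 1)).choose (d + 1) : ℤ)) +
        b * (((n + (d + 1)).choose (d + 1) : ℤ) - ((n + d).choose d : ℤ)) +
        a * ((n + d).choose d : ℤ) := by
  have h0 := simplexSum_succ_left_le hc n
  have h1 := simplexSum_succ_left_le (g := fun β => g (Fin.cons 0 β)) (c := b)
    (fun α hα => hb _ (by simpa using hα)) n
  have h2 := simplexSum_mono (g := fun β => g (Fin.cons 0 (Fin.cons 0 β))) (h := fun _ => a)
    (fun β => ha _) n
  rw [simplexSum_const] at h2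
  linarith

theorem tendsto_comp_mul_add_div_pow {f : ℕ → ℝ} {d : ℕ} {l : ℝ}
    (hf : Tendsto (fun n : ℕ => f n / (n : ℝ) ^ d) atTop (𝓝 l)) {t : ℕ} (ht : 0 < t) (s : ℕ) :
    Tendsto (fun n : ℕ => f (t * n + s) / (n : ℝ) ^ d) atTop (𝓝 (t ^ d * l)) := by
  have hatTop : Tendsto (fun n : ℕ => t * n + s) atTop atTop :=
    tendsto_atTop_mono (fun n => (Nat.le_mul_of_pos_left n ht).trans (Nat.le_add_right _ _))
      tendsto_id
  have hratio : Tendsto (fun n : ℕ => ((t : ℝ) + s / n) ^ d) atTop (𝓝 (t ^ d)) := by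
    simpa using ((tendsto_const_div_atTop_nhds_zero_nat (s : ℝ)).const_add (t : ℝ)).pow d
  refine (hratio.mul (hf.comp hatTop)).congr' ?_
  filter_upwards [eventually_gt_atTop 0] with n hn
  have hn' : (n : ℝ) ≠ 0 := by positivity
  have hts : (t : ℝ) * n + s ≠ 0 := by positivity
  rw [Function.comp_apply, Nat.cast_add, Nat.cast_mul, ← mul_div_assoc,
    show (t : ℝ) + s / n = (t * n + s) / n by field_simp, div_pow]
  field_simp

theorem tendsto_choose_add_div_pow (k : ℕ) :
    Tendsto (fun n : ℕ => ((n + k).choose k : ℝ) / (n : ℝ) ^ k) atTop (𝓝 (k.factorial : ℝ)⁻¹) := by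
  have hchoose : Tendsto (fun n : ℕ => (n.choose k : ℝ) / (n : ℝ) ^ k) atTop
      (𝓝 (k.factorial : ℝ)⁻¹) := by
    refine ((isEquivalent_choose k).div IsEquivalent.refl).symm.tendsto_nhds
      (tendsto_const_nhds.congr' ?_)
    filter_upwards [eventually_gt_atTop 0] with n hn
    simp only [Pi.div_apply]
    field_simp
  simpa using tendsto_comp_mul_add_div_pow hchoose one_pos k

theorem tendsto_sum_choose_div_pow (a : ℕ → ℤ) (d : ℕ) :
    Tendsto (fun n : ℕ => ((∑ j ∈ range (d + 1), a j * ((n + j).choose j : ℤ) : ℤ) : ℝ) /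
      (n : ℝ) ^ d) atTop (𝓝 (a d * (d.factorial : ℝ)⁻¹)) := by
  have hlow : ∀ j ∈ range d, Tendsto (fun n : ℕ => (a j : ℝ) *
      (((n + j).choose j : ℝ) / (n : ℝ) ^ d)) atTop (𝓝 0) := by
    intro j hj
    have hjd : j < d := mem_range.mp hj
    have hpow : Tendsto (fun n : ℕ => ((n : ℝ) ^ (d - j))⁻¹) atTop (𝓝 0) :=
      tendsto_inv_atTop_zero.comp
        ((tendsto_pow_atTop (by omega)).comp tendsto_natCast_atTop_atTop)
    have hlim := ((tendsto_choose_add_div_pow j).mul hpow).const_mul (a j : ℝ)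
    rw [mul_zero, mul_zero] at hlim
    refine hlim.congr fun n => ?_
    rw [← div_eq_mul_inv, div_div, ← pow_add, Nat.add_sub_cancel' hjd.le]
  have hsum := (tendsto_finsetSum _ hlow).add
    ((tendsto_choose_add_div_pow d).const_mul (a d : ℝ))
  rw [sum_const_zero, zero_add] at hsum
  refine hsum.congr fun n => ?_
  push_cast [sum_range_succ, add_div, sum_div, mul_div_assoc]
  rfl

theorem nonneg_of_eventually_nonneg_sum_choose {a : ℕ → ℤ} {d : ℕ}
    (h : ∀ᶠ n : ℕ in atTop, 0 ≤ ∑ j ∈ range (d + 1), a j * ((n + j).choose j : ℤ)) : 0 ≤ a d := by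
  have hlim : (0 : ℝ) ≤ a d * (d.factorial : ℝ)⁻¹ := by
    refine ge_of_tendsto (tendsto_sum_choose_div_pow a d) ?_
    filter_upwards [h] with n hn
    positivity
  exact_mod_cast nonneg_of_mul_nonneg_left hlim (by positivity)

end Combinatorics

/-! ### The monomial filtration and Hilbert coefficients -/

section Monomials

variable {R ι : Type*} [CommRing R]

theorem single_one_le [DecidableEq ι] {α : ι → ℕ} {i : ι} (hi : 0 < α i) :
    Pi.single i 1 ≤ α := by
  intro j
  obtain rfl | hj := eq_or_ne j i
  · simpa using Nat.one_le_iff_ne_zero.mpr hi.ne'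
  · simp [hj]

theorem span_range_pow_le_pow_span_range (x : ι → R) (t : ℕ) :
    Ideal.span (Set.range fun i => x i ^ t) ≤ Ideal.span (Set.range x) ^ t := by
  rw [Ideal.span_le]
  rintro _ ⟨i, rfl⟩
  exact Ideal.pow_mem_pow (Ideal.subset_span (Set.mem_range_self i)) t

variable [Fintype ι]

/-- The monomial `x ^ α` with exponent vector `α` in the elements `x`. -/
def monom (x : ι → R) (α : ι → ℕ) : R := ∏ i, x i ^ α i

theorem monom_add (x : ι → R) (α β : ι → ℕ) : monom x (α + β) = monom x α * monom x β := by
  simp [monom, pow_add, Finset.prod_mul_distrib]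

theorem monom_single [DecidableEq ι] (x : ι → R) (i : ι) : monom x (Pi.single i 1) = x i := by
  simp [monom, Pi.single_apply, Finset.prod_ite_eq']

theorem span_range_pow_eq_span_monom (x : ι → R) (k : ℕ) :
    Ideal.span (Set.range x) ^ k = Ideal.span (monom x '' {α | ∑ i, α i = k}) := by
  classical
  induction k with
  | zero =>
    rw [pow_zero, eq_comm, Ideal.one_eq_top, Ideal.eq_top_iff_one]
    exact Ideal.subset_span ⟨0, by simp, by simp [monom]⟩
  | succ k ih =>
    rw [pow_succ', ih, Ideal.span_mul_span']
    refine congrArg Ideal.span (Set.ext fun r => ⟨?_, ?_⟩)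
    · rintro ⟨_, ⟨i, rfl⟩, _, ⟨α, rfl, rfl⟩, rfl⟩
      exact ⟨Pi.single i 1 + α, by simp [Finset.sum_add_distrib, add_comm],
        by rw [monom_add, monom_single]⟩
    · rintro ⟨α, hα, rfl⟩
      obtain ⟨i, -, hi⟩ := Finset.exists_ne_zero_of_sum_ne_zero (hα.trans_ne k.succ_ne_zero)
      obtain ⟨β, rfl⟩ := exists_add_of_le (single_one_le (Nat.pos_of_ne_zero hi))
      refine ⟨x i, ⟨i, rfl⟩, monom x β, ⟨β, ?_, rfl⟩, by rw [monom_add, monom_single]⟩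
      simpa [Finset.sum_add_distrib, add_comm] using hα

theorem monom_mem_span_range_pow (x : ι → R) (α : ι → ℕ) :
    monom x α ∈ Ideal.span (Set.range x) ^ ∑ i, α i := by
  rw [span_range_pow_eq_span_monom]
  exact Ideal.subset_span ⟨α, rfl, rfl⟩

theorem pow_span_range_le_span_range_pow_pow (x : ι → R) {t : ℕ} (ht : 0 < t) (n : ℕ) :
    Ideal.span (Set.range x) ^ (t * n + t * Fintype.card ι) ≤
      Ideal.span (Set.range fun i => x i ^ t) ^ n := by
  rw [span_range_pow_eq_span_monom, Ideal.span_le]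
  rintro _ ⟨α, hα, rfl⟩
  have hmonom : monom x α = monom (fun i => x i ^ t) (fun i => α i / t) *
      monom x (fun i => α i % t) := by
    simp only [monom, ← Finset.prod_mul_distrib, ← pow_mul, ← pow_add, Nat.div_add_mod]
  have hdeg : n ≤ ∑ i, α i / t := by
    have hle : ∑ i, α i ≤ ∑ i, (t * (α i / t) + t) := Finset.sum_le_sum fun i _ =>
      (Nat.div_add_mod (α i) t).symm.le.trans (Nat.add_le_add_left (Nat.mod_lt _ ht).le _)
    rw [show ∑ i, α i = _ from hα, Finset.sum_add_distrib, ← Finset.mul_sum, Finset.sum_const,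
      Finset.card_univ, smul_eq_mul, mul_comm (Fintype.card ι)] at hle
    exact Nat.le_of_mul_le_mul_left (Nat.le_of_add_le_add_right hle) ht
  rw [SetLike.mem_coe, hmonom]
  exact Ideal.mul_mem_right _ _ (Ideal.pow_le_pow_right hdeg (monom_mem_span_range_pow _ _))

section LeadIdeal

variable [LinearOrder ι]

/-- The ideal generated by the monomials that precede `x ^ α` in the monomial filtration: those of
larger degree, and those of the same degree whose exponent is lexicographically smaller. -/
def precedingIdeal (x : ι → R) (α : ι → ℕ) : Ideal R :=
  Ideal.span (Set.range x) ^ (∑ i, α i + 1) ⊔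
    Ideal.span (monom x '' {β | ∑ i, β i = ∑ i, α i ∧ toLex β < toLex α})

/-- The annihilator of `x ^ α` modulo the preceding monomials, so that the graded pieces of the
monomial filtration are the rings `R ⧸ leadIdeal x α`. -/
def leadIdeal (x : ι → R) (α : ι → ℕ) : Ideal R := (precedingIdeal x α).colon {monom x α}

variable {x : ι → R} {α β : ι → ℕ}

theorem mem_leadIdeal {a : R} : a ∈ leadIdeal x α ↔ a * monom x α ∈ precedingIdeal x α :=
  mem_colon_singleton_iff_mul_mem

theorem precedingIdeal_mul_monom_le (x : ι → R) (α γ : ι → ℕ) :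
    precedingIdeal x α * Ideal.span {monom x γ} ≤ precedingIdeal x (α + γ) := by
  rw [precedingIdeal, precedingIdeal, Ideal.sup_mul]
  refine sup_le_sup ?_ ?_
  · rw [show ∑ i, (α + γ) i + 1 = (∑ i, α i + 1) + ∑ i, γ i by
      simp only [Pi.add_apply, Finset.sum_add_distrib]; ring, pow_add _ (∑ i, α i + 1)]
    exact Ideal.mul_mono_right
      ((Ideal.span_singleton_le_iff_mem _).mpr (monom_mem_span_range_pow x γ))
  · rw [Ideal.span_mul_span', Ideal.span_le]
    rintro _ ⟨_, ⟨β, ⟨hdeg, hlt⟩, rfl⟩, _, rfl, rfl⟩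
    refine Ideal.subset_span ⟨β + γ, ⟨?_, ?_⟩, monom_add x β γ⟩
    · simp only [Pi.add_apply, Finset.sum_add_distrib, hdeg]
    · rw [toLex_add, toLex_add]
      exact add_lt_add_left hlt _

theorem leadIdeal_mono (x : ι → R) : Monotone (leadIdeal x) := by
  intro α β hαβ a ha
  obtain ⟨γ, rfl⟩ := exists_add_of_le hαβ
  rw [mem_leadIdeal] at ha ⊢
  rw [monom_add, ← mul_assoc]
  exact precedingIdeal_mul_monom_le x α γ
    (Ideal.mul_mem_mul ha (Ideal.mem_span_singleton_self _))

theorem span_range_le_leadIdeal (x : ι → R) (α : ι → ℕ) :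
    Ideal.span (Set.range x) ≤ leadIdeal x α := by
  intro a ha
  rw [mem_leadIdeal, mul_comm]
  exact Ideal.mem_sup_left
    (pow_succ (Ideal.span (Set.range x)) _ ▸ Ideal.mul_mem_mul (monom_mem_span_range_pow x α) ha)

theorem colon_le_leadIdeal_single (x : ι → R) (i : ι) :
    (Ideal.span (x '' Set.Ioi i)).colon {x i} ≤ leadIdeal x (Pi.single i 1) := by
  intro a ha
  rw [mem_colon_singleton_iff_mul_mem] at ha
  rw [mem_leadIdeal, monom_single]
  refine Ideal.mem_sup_right (Ideal.span_mono ?_ ha)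
  rintro _ ⟨j, hj, rfl⟩
  refine ⟨Pi.single j 1, ⟨by simp, i, fun k hk => ?_, ?_⟩, monom_single x j⟩
  · simp [hk.ne, (hk.trans hj).ne]
  · simp [(Set.mem_Ioi.mp hj).ne]

theorem colon_sup_span_range_le_leadIdeal {i : ι} (hi : 0 < α i) :
    (Ideal.span (x '' Set.Ioi i)).colon {x i} ⊔ Ideal.span (Set.range x) ≤ leadIdeal x α :=
  sup_le ((colon_le_leadIdeal_single x i).trans
    (leadIdeal_mono x (single_one_le hi))) (span_range_le_leadIdeal x α)

end LeadIdeal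

variable {d : ℕ} {x : Fin d → R}

theorem colength_span_range_pow_succ (k : ℕ)
    (hfin : IsFiniteLength R (R ⧸ Ideal.span (Set.range x) ^ (k + 1))) :
    colength (Ideal.span (Set.range x) ^ (k + 1)) = colength (Ideal.span (Set.range x) ^ k) +
      ∑ α ∈ Finset.Nat.antidiagonalTuple d k, colength (leadIdeal x α) := by
  rw [colength_eq_sum_colon toLex.injective (monom x) hfin (Finset.Nat.antidiagonalTuple d k)]
  have hcoe : (Finset.Nat.antidiagonalTuple d k : Set (Fin d → ℕ)) = {α | ∑ i, α i = k} :=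
    Set.ext fun α => by simp [Finset.Nat.mem_antidiagonalTuple]
  congr 1
  · rw [hcoe, ← span_range_pow_eq_span_monom, sup_eq_right.mpr (Ideal.pow_le_pow_right k.le_succ)]
  · refine Finset.sum_congr rfl fun α hα => ?_
    rw [Finset.Nat.mem_antidiagonalTuple] at hα
    simp only [leadIdeal, precedingIdeal, hα, Finset.Nat.mem_antidiagonalTuple]
    rfl

theorem colength_span_range_pow_succ_eq_simplexSum
    (hfin : ∀ k, IsFiniteLength R (R ⧸ Ideal.span (Set.range x) ^ k)) (n : ℕ) :
    colength (Ideal.span (Set.range x) ^ (n + 1)) =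
      simplexSum d (fun α => colength (leadIdeal x α)) n := by
  induction n with
  | zero =>
    rw [colength_span_range_pow_succ 0 (hfin _), pow_zero, Ideal.one_eq_top, colength_top,
      simplexSum]
    simp
  | succ n ih =>
    rw [colength_span_range_pow_succ _ (hfin _), ih, simplexSum, simplexSum,
      Finset.sum_range_succ _ (n + 1)]

theorem exists_isHilbertCoeffs (hd : ringKrullDim R = (d : WithBot ℕ∞))
    (hfin : ∀ k, IsFiniteLength R (R ⧸ Ideal.span (Set.range x) ^ k)) :
    ∃ e : ℕ → ℤ, IsHilbertCoeffs (Ideal.span (Set.range x)) e := by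
  have hQ : IsFiniteLength R (R ⧸ Ideal.span (Set.range x)) := by
    have := hfin 1
    rwa [pow_one] at this
  have hanti : Antitone fun α => (Module.length R (R ⧸ leadIdeal x α)).toNat := fun α β hαβ =>
    Int.ofNat_le.mp <| colength_mono
      (isFiniteLength_quotient_of_le hQ (span_range_le_leadIdeal x α)) (leadIdeal_mono x hαβ)
  obtain ⟨a, ha⟩ := (eventuallyPoly_simplexSum hanti).exists_coeffs
  refine ⟨fun i => if i ≤ d then (-1) ^ i * a (d - i) else 0, d, hd,
    fun i hi => if_neg (not_le.mpr hi), ?_⟩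
  filter_upwards [ha] with n hn
  refine (colength_span_range_pow_succ_eq_simplexSum hfin n).trans (hn.trans ?_)
  rw [← Finset.sum_range_reflect]
  refine Finset.sum_congr rfl fun i hi => ?_
  have hid : i ≤ d := Nat.lt_succ_iff.mp (Finset.mem_range.mp hi)
  rw [if_pos hid, Nat.add_sub_assoc hid, ← mul_assoc, ← pow_add, Even.neg_one_pow ⟨i, rfl⟩, one_mul,
    Nat.add_sub_cancel]

end Monomials

/-! ### Systems of parameters -/

section Parameters

open Filter Topology

variable {R : Type*} [CommRing R] [IsLocalRing R]

namespace IsSystemOfParameters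

variable {d : ℕ} {x : Fin d → R}

theorem mem_maximalIdeal (hx : IsSystemOfParameters x) (i : Fin d) :
    x i ∈ IsLocalRing.maximalIdeal R :=
  hx.2 ▸ Ideal.le_radical (Ideal.subset_span (Set.mem_range_self i))

theorem of_mem_radical (hx : IsSystemOfParameters x) {y : Fin d → R}
    (hy : ∀ i, y i ∈ IsLocalRing.maximalIdeal R)
    (h : ∀ i, x i ∈ (Ideal.span (Set.range y)).radical) : IsSystemOfParameters y := by
  refine ⟨hx.1, le_antisymm ?_ ?_⟩
  · rw [Ideal.IsPrime.radical_le_iff inferInstance, Ideal.span_le]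
    exact Set.range_subset_iff.mpr hy
  · rw [← hx.2, Ideal.radical_le_radical_iff, Ideal.span_le]
    exact Set.range_subset_iff.mpr h

theorem pow (hx : IsSystemOfParameters x) {m : Fin d → ℕ} (hm : ∀ i, 0 < m i) :
    IsSystemOfParameters fun i => x i ^ m i :=
  hx.of_mem_radical (fun i => Ideal.pow_mem_of_mem _ (hx.mem_maximalIdeal i) _ (hm i))
    fun i => ⟨m i, Ideal.subset_span ⟨i, rfl⟩⟩

variable [IsNoetherianRing R]

theorem exists_pow_le (hx : IsSystemOfParameters x) :
    ∃ N, IsLocalRing.maximalIdeal R ^ N ≤ Ideal.span (Set.range x) :=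
  hx.2 ▸ Ideal.exists_radical_pow_le_of_fg _ (IsNoetherian.noetherian _)

theorem isFiniteLength_quotient_pow (hx : IsSystemOfParameters x) (k : ℕ) :
    IsFiniteLength R (R ⧸ Ideal.span (Set.range x) ^ k) := by
  obtain ⟨N, hN⟩ := hx.exists_pow_le
  exact isFiniteLength_quotient_of_pow_le ((pow_mul _ N k).trans_le (Ideal.pow_right_mono hN k))

theorem isFiniteLength_quotient (hx : IsSystemOfParameters x) :
    IsFiniteLength R (R ⧸ Ideal.span (Set.range x)) :=
  hx.exists_pow_le.elim fun _ => isFiniteLength_quotient_of_pow_le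

theorem isHilbertCoeffs (hx : IsSystemOfParameters x) :
    IsHilbertCoeffs (Ideal.span (Set.range x)) (hilbertCoeff (Ideal.span (Set.range x))) := by
  have h := exists_isHilbertCoeffs hx.1 hx.isFiniteLength_quotient_pow
  rw [show hilbertCoeff (Ideal.span (Set.range x)) = h.choose from funext fun _ => dif_pos h]
  exact h.choose_spec

theorem eventually_colength_pow_eq (hx : IsSystemOfParameters x) :
    ∀ᶠ n : ℕ in atTop, colength (Ideal.span (Set.range x) ^ (n + 1)) =
      ∑ j ∈ Finset.range (d + 1),
        (-1) ^ (d - j) * hilbertCoeff (Ideal.span (Set.range x)) (d - j) *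
          ((n + j).choose j : ℤ) := by
  obtain ⟨d', hd', -, h⟩ := hx.isHilbertCoeffs
  obtain rfl : d = d' := by exact_mod_cast hx.1.symm.trans hd'
  filter_upwards [h] with n hn
  refine hn.trans ?_
  rw [← Finset.sum_range_reflect]
  refine Finset.sum_congr rfl fun j hj => ?_
  have hjd : j ≤ d := Nat.lt_succ_iff.mp (Finset.mem_range.mp hj)
  rw [Nat.add_sub_cancel, Nat.add_sub_assoc (Nat.sub_le d j), Nat.sub_sub_self hjd]

theorem tendsto_colength_pow (hx : IsSystemOfParameters x) :
    Tendsto (fun n : ℕ => (colength (Ideal.span (Set.range x) ^ (n + 1)) : ℝ) / (n : ℝ) ^ d) atTop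
      (𝓝 (hilbertCoeff (Ideal.span (Set.range x)) 0 * (d.factorial : ℝ)⁻¹)) := by
  have h := tendsto_sum_choose_div_pow
    (fun j => (-1) ^ (d - j) * hilbertCoeff (Ideal.span (Set.range x)) (d - j)) d
  rw [Nat.sub_self, pow_zero, one_mul] at h
  refine h.congr' ?_
  filter_upwards [hx.eventually_colength_pow_eq] with n hn
  rw [hn]

theorem hilbertCoeff_zero_pow (hx : IsSystemOfParameters x) {t : ℕ} (ht : 0 < t) :
    hilbertCoeff (Ideal.span (Set.range fun i => x i ^ t)) 0 =
      t ^ d * hilbertCoeff (Ideal.span (Set.range x)) 0 := by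
  have hxt : IsSystemOfParameters fun i => x i ^ t := hx.pow fun _ => ht
  have hlower : ∀ n, colength (Ideal.span (Set.range x) ^ (t * n + (t - 1) + 1)) ≤
      colength (Ideal.span (Set.range fun i => x i ^ t) ^ (n + 1)) := by
    intro n
    refine colength_mono (hxt.isFiniteLength_quotient_pow _) ?_
    rw [show t * n + (t - 1) + 1 = t * (n + 1) by rw [mul_add]; omega, pow_mul]
    exact Ideal.pow_right_mono (span_range_pow_le_pow_span_range x t) _
  have hupper : ∀ n, colength (Ideal.span (Set.range fun i => x i ^ t) ^ (n + 1)) ≤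
      colength (Ideal.span (Set.range x) ^ (t * n + (t - 1 + t * d) + 1)) := by
    intro n
    refine colength_mono (hx.isFiniteLength_quotient_pow _) ?_
    rw [show t * n + (t - 1 + t * d) + 1 = t * (n + 1) + t * Fintype.card (Fin d) by
      rw [mul_add, Fintype.card_fin]; omega]
    exact pow_span_range_le_span_range_pow_pow x ht _
  have hlim := hxt.tendsto_colength_pow
  have hge := le_of_tendsto_of_tendsto'
    (tendsto_comp_mul_add_div_pow hx.tendsto_colength_pow ht (t - 1)) hlim fun n =>
      div_le_div_of_nonneg_right (Int.cast_le.mpr (hlower n)) (by positivity)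
  have hle := le_of_tendsto_of_tendsto' hlim
    (tendsto_comp_mul_add_div_pow hx.tendsto_colength_pow ht (t - 1 + t * d)) fun n =>
      div_le_div_of_nonneg_right (Int.cast_le.mpr (hupper n)) (by positivity)
  have heq := le_antisymm hle hge
  rw [← mul_assoc] at heq
  exact_mod_cast mul_right_cancel₀ (by positivity) heq

theorem hilbertCoeff_zero_sub_le_hilbertCoeff_one {D : ℕ} {x : Fin (D + 2) → R}
    (hx : IsSystemOfParameters x)
    (h0 : colength ((Ideal.span (x '' Set.Ioi 0)).colon {x 0} ⊔ Ideal.span (Set.range x)) =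
      hilbertCoeff (Ideal.span (Set.range x)) 0) :
    hilbertCoeff (Ideal.span (Set.range x)) 0 -
      colength ((Ideal.span (x '' Set.Ioi 1)).colon {x 1} ⊔ Ideal.span (Set.range x)) ≤
      hilbertCoeff (Ideal.span (Set.range x)) 1 := by
  set e := hilbertCoeff (Ideal.span (Set.range x))
  set a := colength (Ideal.span (Set.range x))
  set b := colength ((Ideal.span (x '' Set.Ioi 1)).colon {x 1} ⊔ Ideal.span (Set.range x))
  have hQ := hx.isFiniteLength_quotient
  have hcolon (i : Fin (D + 2)) (α : Fin (D + 2) → ℕ) (hα : 0 < α i) : colength (leadIdeal x α) ≤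
      colength ((Ideal.span (x '' Set.Ioi i)).colon {x i} ⊔ Ideal.span (Set.range x)) :=
    colength_mono (isFiniteLength_quotient_of_le hQ le_sup_right)
      (colon_sup_span_range_le_leadIdeal hα)
  have hbound := simplexSum_add_two_le (g := fun α => colength (leadIdeal x α))
    (fun α => colength_mono hQ (span_range_le_leadIdeal x α)) (hcolon 1)
    (fun α hα => h0 ▸ hcolon 0 α hα)
  -- In the bound, the coefficient of `C(n + D + 2, D + 2)` is `e 0`, as in the Hilbert polynomial.
  have hdiff : 0 ≤ (Pi.single (D + 1) (b - e 0) + Pi.single D (a - b) -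
      fun j => (-1) ^ (D + 2 - j) * e (D + 2 - j) : ℕ → ℤ) (D + 1) := by
    refine nonneg_of_eventually_nonneg_sum_choose ?_
    filter_upwards [hx.eventually_colength_pow_eq] with n hn
    have hn_le := hbound n
    rw [← colength_span_range_pow_succ_eq_simplexSum hx.isFiniteLength_quotient_pow, hn,
      Finset.sum_range_succ, Nat.sub_self, pow_zero, one_mul] at hn_le
    simp only [Pi.add_apply, Pi.sub_apply, Pi.single_apply, add_mul, sub_mul, ite_mul, zero_mul,
      Finset.sum_add_distrib, Finset.sum_sub_distrib, Finset.sum_ite_eq', Finset.mem_range,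
      Nat.lt_succ_self, if_true, Nat.lt_succ_of_lt (Nat.lt_succ_self D)]
    linear_combination hn_le
  simp only [Pi.sub_apply, Pi.add_apply, Pi.single_eq_same, ne_eq, Nat.add_eq_left, one_ne_zero,
    not_false_eq_true, Pi.single_eq_of_ne, add_zero, Nat.reduceSubDiff, add_tsub_cancel_left,
    pow_one, neg_mul, one_mul, sub_neg_eq_add] at hdiff
  linarith

end IsSystemOfParameters

end Parameters

/-! ### Colon ideals -/

section Colon

theorem image_update_of_notMem {ι β : Type*} [DecidableEq ι] (x : ι → β) {i : ι} {J : Set ι}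
    (hi : i ∉ J) (b : β) : Function.update x i b '' J = x '' J :=
  Set.image_congr fun _ hj => Function.update_of_ne (ne_of_mem_of_not_mem hj hi) _ _

variable {R : Type*} [CommRing R]

theorem mem_sup_span_singleton {I : Ideal R} {a b : R} :
    a ∈ I ⊔ Ideal.span {b} ↔ ∃ r, a - r * b ∈ I := by
  rw [sup_comm, Ideal.mem_span_singleton_sup]
  exact exists_congr fun r =>
    ⟨fun ⟨c, hc, h⟩ => h ▸ by rwa [add_sub_cancel_left], fun h => ⟨_, h, add_sub_cancel _ _⟩⟩

theorem monotone_colon_pow (I : Ideal R) (y : R) : Monotone fun n => I.colon {y ^ n} := by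
  intro m n hmn a ha
  obtain ⟨k, rfl⟩ := Nat.exists_eq_add_of_le hmn
  rw [mem_colon_singleton_iff_mul_mem] at ha ⊢
  rw [pow_add, ← mul_assoc]
  exact I.mul_mem_right _ ha

theorem colength_sup_span_pow_succ {I : Ideal R} {y : R}
    (hfin : ∀ n, IsFiniteLength R (R ⧸ (I ⊔ Ideal.span {y ^ n}))) (n : ℕ) :
    colength (I ⊔ Ideal.span {y ^ (n + 1)}) =
      colength (I ⊔ Ideal.span {y ^ n}) + colength (I.colon {y ^ n} ⊔ Ideal.span {y}) := by
  rw [colength_eq_add_colon (hfin (n + 1)) (y ^ n)]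
  congr 2
  · rw [sup_assoc, sup_eq_right.mpr
      (Ideal.span_singleton_le_span_singleton.mpr (pow_dvd_pow y n.le_succ))]
  · ext a
    simp only [mem_colon_singleton_iff_mul_mem, mem_sup_span_singleton, pow_succ', sub_mul,
      mul_assoc]

theorem colength_sup_span_pow_le {I : Ideal R} {y : R}
    (hfin : ∀ n, IsFiniteLength R (R ⧸ (I ⊔ Ideal.span {y ^ n}))) (n : ℕ) :
    colength (I ⊔ Ideal.span {y ^ n}) ≤ n * colength (I ⊔ Ideal.span {y}) := by
  induction n with
  | zero => simp [colength_top]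
  | succ n ih =>
    have hle : colength (I.colon {y ^ n} ⊔ Ideal.span {y}) ≤ colength (I ⊔ Ideal.span {y}) :=
      colength_mono (pow_one y ▸ hfin 1) (sup_le_sup_right Ideal.le_colon _)
    rw [colength_sup_span_pow_succ hfin]
    push_cast
    linarith

theorem colon_pow_le_colon [IsNoetherianRing R] {I : Ideal R} {y : R}
    (hy : y ∈ (⊥ : Ideal R).jacobson)
    (h : ∀ n, I.colon {y ^ n} ≤ I.colon {y} ⊔ Ideal.span {y}) (n : ℕ) :
    I.colon {y ^ n} ≤ I.colon {y} := by
  obtain ⟨N, hN⟩ := monotone_stabilizes_iff_noetherian.mpr ‹IsNoetherianRing R›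
    ⟨_, monotone_colon_pow I y⟩
  have hstable : ∀ m, N ≤ m → I.colon {y ^ N} = I.colon {y ^ m} := hN
  set M := N + n + 1
  have hle : I.colon {y} ≤ I.colon {y ^ M} := by
    simpa only [pow_one] using monotone_colon_pow I y (show 1 ≤ M by omega)
  refine (monotone_colon_pow I y (show n ≤ M by omega)).trans ?_
  refine Submodule.le_of_le_smul_of_le_jacobson_bot (I := Ideal.span {y})
    (IsNoetherian.noetherian _) ((Ideal.span_singleton_le_iff_mem _).mpr hy) fun b hb => ?_
  obtain ⟨r, hr⟩ := mem_sup_span_singleton.mp (h M hb)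
  have hr_mem : r ∈ I.colon {y ^ M} := by
    rw [← hstable M (by omega), hstable (M + 1) (by omega), mem_colon_singleton_iff_mul_mem,
      pow_succ', ← mul_assoc, ← mem_colon_singleton_iff_mul_mem]
    simpa only [sub_sub_cancel] using sub_mem hb (hle hr)
  rw [← sub_add_cancel b (r * y)]
  refine Submodule.add_mem_sup hr ?_
  rw [mul_comm]
  exact Submodule.smul_mem_smul (Ideal.mem_span_singleton_self y) hr_mem

variable {ι : Type*}

theorem span_image_insert (x : ι → R) (i : ι) (J : Set ι) :
    Ideal.span (x '' insert i J) = Ideal.span (x '' J) ⊔ Ideal.span {x i} := by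
  rw [Set.image_insert_eq, Ideal.span_insert, sup_comm]

theorem span_range_eq_sup (x : ι → R) (i : ι) :
    Ideal.span (Set.range x) = Ideal.span (x '' {i}ᶜ) ⊔ Ideal.span {x i} := by
  rw [← span_image_insert, Set.insert_eq, Set.union_compl_self, Set.image_univ]

theorem span_range_update [DecidableEq ι] (x : ι → R) (i : ι) (a : R) :
    Ideal.span (Set.range (Function.update x i a)) = Ideal.span (x '' {i}ᶜ) ⊔ Ideal.span {a} := by
  rw [span_range_eq_sup _ i, image_update_of_notMem x (J := {i}ᶜ) (by simp),
    Function.update_self]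

theorem span_image_compl_singleton (x : ι → R) {i j : ι} (hij : i ≠ j) :
    Ideal.span (x '' {i}ᶜ) = Ideal.span (x '' {i, j}ᶜ) ⊔ Ideal.span {x j} := by
  rw [← span_image_insert, show insert j {i, j}ᶜ = ({i}ᶜ : Set ι) by ext; grind]

end Colon

section PowOn

variable {R ι : Type*} [CommRing R]

open Classical in
/-- The family obtained from `x` by replacing `x j` with `x j ^ n` for all `j ∈ S`. -/
noncomputable def powOn (x : ι → R) (S : Set ι) (n : ℕ) : ι → R :=
  fun j => x j ^ if j ∈ S then n else 1

variable {x : ι → R} {S T : Set ι} {j : ι} {n : ℕ}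

theorem powOn_of_mem (hj : j ∈ S) : powOn x S n j = x j ^ n := by
  rw [powOn, if_pos hj]

theorem powOn_of_notMem (hj : j ∉ S) : powOn x S n j = x j := by
  rw [powOn, if_neg hj, pow_one]

theorem powOn_empty : powOn x ∅ n = x :=
  funext fun j => powOn_of_notMem (Set.notMem_empty j)

theorem powOn_univ : powOn x Set.univ n = fun j => x j ^ n :=
  funext fun j => powOn_of_mem (Set.mem_univ j)

theorem powOn_insert [DecidableEq ι] (hj : j ∉ S) :
    powOn x (insert j S) n = Function.update (powOn x S n) j (powOn x S n j ^ n) := by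
  rw [powOn_of_notMem hj]
  funext l
  obtain rfl | hl := eq_or_ne l j
  · rw [powOn_of_mem (Set.mem_insert l S), Function.update_self]
  · rw [Function.update_of_ne hl]
    by_cases hS : l ∈ S
    · rw [powOn_of_mem hS, powOn_of_mem (.inr hS)]
    · rw [powOn_of_notMem hS, powOn_of_notMem (by simp [hl, hS])]

theorem powOn_powOn (hST : Disjoint S T) : powOn (powOn x S n) T n = powOn x (S ∪ T) n := by
  funext j
  by_cases hS : j ∈ S
  · rw [powOn_of_notMem (hST.notMem_of_mem_left hS), powOn_of_mem hS, powOn_of_mem (.inl hS)]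
  by_cases hT : j ∈ T
  · rw [powOn_of_mem hT, powOn_of_notMem hS, powOn_of_mem (.inr hT)]
  · rw [powOn_of_notMem hT, powOn_of_notMem hS, powOn_of_notMem (by simp [hS, hT])]

theorem powOn_pow (x : ι → R) (S : Set ι) (m t : ℕ) :
    (fun j => powOn x S m j ^ t) = powOn (fun j => x j ^ t) S m :=
  funext fun _ => pow_right_comm _ _ _

theorem image_powOn_of_disjoint (hST : Disjoint S T) : powOn x S n '' T = x '' T :=
  Set.image_congr fun _ hj => powOn_of_notMem (hST.notMem_of_mem_right hj)

theorem span_range_powOn_singleton (x : ι → R) (i : ι) (n : ℕ) :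
    Ideal.span (Set.range (powOn x {i} n)) =
      Ideal.span (x '' {i}ᶜ) ⊔ Ideal.span {x i ^ n} := by
  rw [span_range_eq_sup _ i, image_powOn_of_disjoint disjoint_compl_right,
    powOn_of_mem (Set.mem_singleton i)]

theorem span_image_le_span_powOn {J : Set ι} {i : ι} (hi : i ∉ J) (n : ℕ) :
    Ideal.span (x '' J) ≤ Ideal.span (powOn x (insert i J)ᶜ n '' {i}ᶜ) := by
  rw [← image_powOn_of_disjoint (S := (insert i J)ᶜ) (n := n)
    (Set.disjoint_compl_left_iff_subset.mpr (Set.subset_insert i J))]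
  exact Ideal.span_mono (Set.image_mono (Set.subset_compl_singleton_iff.mpr hi))

theorem IsSystemOfParameters.powOn [IsLocalRing R] {d : ℕ} {x : Fin d → R}
    (hx : IsSystemOfParameters x) (S : Set (Fin d)) (hn : 0 < n) :
    IsSystemOfParameters (powOn x S n) := by
  classical
  exact hx.pow fun j => by split_ifs <;> omega

end PowOn

/-! ### Multiplicities in Buchsbaum rings -/

section Buchsbaum

variable {R : Type*} [CommRing R] [IsLocalRing R] {d : ℕ} {x : Fin d → R}

/-- The multiplicity `e₀` of the ideal generated by the system of parameters `x`. -/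
noncomputable abbrev paramMult (x : Fin d → R) : ℤ := hilbertCoeff (Ideal.span (Set.range x)) 0

theorem IsBuchsbaum.exists_colength_eq (hB : IsBuchsbaum R) :
    ∃ c : ℤ, ∀ {d : ℕ} {x : Fin d → R}, IsSystemOfParameters x →
      colength (Ideal.span (Set.range x)) = paramMult x + c :=
  hB.imp fun _ hc d x hx => sub_eq_iff_eq_add'.mp (hc _ ⟨d, x, hx, rfl⟩)

theorem nonpos_of_forall_pow_mul_le {a b : ℤ} {d : ℕ} (hd : d ≠ 0)
    (h : ∀ t : ℕ, 0 < t → (t : ℤ) ^ d * a ≤ b) : a ≤ 0 := by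
  by_contra! ha
  have hle := h (b.natAbs + 1) b.natAbs.succ_pos
  have hself : ((b.natAbs + 1 : ℕ) : ℤ) ≤ ((b.natAbs + 1 : ℕ) : ℤ) ^ d :=
    le_self_pow₀ (by exact_mod_cast b.natAbs.succ_pos) hd
  have hmul : ((b.natAbs + 1 : ℕ) : ℤ) ^ d ≤ ((b.natAbs + 1 : ℕ) : ℤ) ^ d * a :=
    le_mul_of_one_le_right (by positivity) ha
  have hb : b < ((b.natAbs + 1 : ℕ) : ℤ) := Int.lt_add_one_of_le Int.le_natAbs
  linarith

variable [IsNoetherianRing R]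

theorem IsSystemOfParameters.isFiniteLength_quotient_sup_span_pow (hx : IsSystemOfParameters x)
    (i : Fin d) (n : ℕ) :
    IsFiniteLength R (R ⧸ (Ideal.span (x '' {i}ᶜ) ⊔ Ideal.span {x i ^ n})) := by
  refine isFiniteLength_quotient_of_le (hx.powOn {i} n.succ_pos).isFiniteLength_quotient ?_
  rw [span_range_powOn_singleton]
  exact sup_le_sup_left
    (Ideal.span_singleton_le_span_singleton.mpr (pow_dvd_pow _ n.le_succ)) _

namespace IsBuchsbaum

variable (hB : IsBuchsbaum R) (hx : IsSystemOfParameters x)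
include hB hx

-- Applied to the powers `x j ^ t`, the length estimate for `x i ^ m` has leading term
-- `t ^ d * e₀` in `t`, whereas its error term is independent of `t`.
theorem paramMult_powOn_singleton_le (i : Fin d) {m : ℕ} (hm : 0 < m) :
    paramMult (powOn x {i} m) ≤ m * paramMult x := by
  obtain ⟨c, hc⟩ := hB.exists_colength_eq
  refine sub_nonpos.mp (nonpos_of_forall_pow_mul_le i.pos.ne' (b := (m - 1) * c) fun t ht => ?_)
  have hxt : IsSystemOfParameters fun j => x j ^ t := hx.pow fun _ => ht
  have hle := colength_sup_span_pow_le (hxt.isFiniteLength_quotient_sup_span_pow i) m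
  rw [← span_range_powOn_singleton, ← span_range_eq_sup (fun j => x j ^ t) i,
    hc (hxt.powOn {i} hm), hc hxt, ← powOn_pow, paramMult, paramMult,
    (hx.powOn {i} hm).hilbertCoeff_zero_pow ht, hx.hilbertCoeff_zero_pow ht] at hle
  linear_combination hle

theorem paramMult_powOn_le {m : ℕ} (hm : 0 < m) (S : Finset (Fin d)) :
    paramMult (powOn x S m) ≤ m ^ S.card * paramMult x := by
  induction S using Finset.induction_on with
  | empty => simp [powOn_empty]
  | insert i S hi ih =>
    rw [Finset.coe_insert, Set.insert_eq, Set.union_comm,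
      ← powOn_powOn (Set.disjoint_singleton_right.mpr hi), Finset.card_insert_of_notMem hi,
      pow_succ', mul_assoc]
    exact (hB.paramMult_powOn_singleton_le (hx.powOn S hm) i hm).trans
      (mul_le_mul_of_nonneg_left ih (by positivity))

theorem paramMult_powOn {m : ℕ} (hm : 0 < m) (S : Finset (Fin d)) :
    paramMult (powOn x S m) = m ^ S.card * paramMult x := by
  refine le_antisymm (hB.paramMult_powOn_le hx hm S) ?_
  have hd : (m : ℤ) ^ d = m ^ (d - S.card) * m ^ S.card := by
    rw [← pow_add, Nat.sub_add_cancel (card_finset_fin_le S)]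
  have hle := hB.paramMult_powOn_le (hx.powOn S hm) hm Sᶜ
  rw [Finset.coe_compl, powOn_powOn disjoint_compl_right, Set.union_compl_self, powOn_univ,
    paramMult, hx.hilbertCoeff_zero_pow hm, Finset.card_compl, Fintype.card_fin, hd,
    mul_assoc] at hle
  exact le_of_mul_le_mul_left hle (by positivity)

theorem colength_colon_pow_sup (i : Fin d) (n : ℕ) :
    colength ((Ideal.span (x '' {i}ᶜ)).colon {x i ^ (n + 1)} ⊔ Ideal.span {x i}) =
      paramMult x := by
  obtain ⟨c, hc⟩ := hB.exists_colength_eq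
  have hpow (m : ℕ) (hm : 0 < m) :
      colength (Ideal.span (x '' {i}ᶜ) ⊔ Ideal.span {x i ^ m}) = m * paramMult x + c := by
    rw [← span_range_powOn_singleton, hc (hx.powOn {i} hm), ← Finset.coe_singleton,
      hB.paramMult_powOn hx hm, Finset.card_singleton, pow_one]
  have hsucc := colength_sup_span_pow_succ (hx.isFiniteLength_quotient_sup_span_pow i) (n + 1)
  rw [hpow _ n.succ_pos, hpow _ (n + 1).succ_pos] at hsucc
  push_cast at hsucc
  linarith

theorem colon_pow_le_colon_compl (i : Fin d) (n : ℕ) :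
    (Ideal.span (x '' {i}ᶜ)).colon {x i ^ n} ≤ (Ideal.span (x '' {i}ᶜ)).colon {x i} := by
  refine colon_pow_le_colon
    (IsLocalRing.maximalIdeal_le_jacobson _ (hx.mem_maximalIdeal i)) (fun n => ?_) n
  have hfin := hx.isFiniteLength_quotient_sup_span_pow i 1
  have hcolength := hB.colength_colon_pow_sup hx i 0
  have hle := monotone_colon_pow (Ideal.span (x '' {i}ᶜ)) (x i) (Nat.le_add_left 1 n)
  rw [pow_one] at hfin
  simp only [zero_add, pow_one] at hcolength hle
  rw [eq_of_le_of_colength_le (isFiniteLength_quotient_of_le hfin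
    (sup_le_sup_right Ideal.le_colon _)) (sup_le_sup_right hle _)
    (by rw [hcolength, hB.colength_colon_pow_sup hx i n])]
  exact (monotone_colon_pow _ _ n.le_succ).trans le_sup_left

end IsBuchsbaum

end Buchsbaum

/-! ### The ideals `((x_j)_{j ≠ i} : x_i) + Q` and the limit closure -/

section ColonSup

variable {R ι : Type*} [CommRing R]

/-- The ideal `((x_j)_{j ≠ i} : x_i) + Q`, where `Q` is generated by the family `x`. For a system
of parameters of a Buchsbaum ring its colength is `e₀(Q)`. -/
noncomputable def colonSup (x : ι → R) (i : ι) : Ideal R :=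
  (Ideal.span (x '' {i}ᶜ)).colon {x i} ⊔ Ideal.span (Set.range x)

theorem colonSup_eq (x : ι → R) (i : ι) :
    colonSup x i = (Ideal.span (x '' {i}ᶜ)).colon {x i} ⊔ Ideal.span {x i} := by
  rw [colonSup, span_range_eq_sup x i, ← sup_assoc,
    sup_eq_left.mpr (Ideal.le_colon (I := Ideal.span (x '' {i}ᶜ)))]

theorem colon_le_colonSup (x : ι → R) {J : Set ι} {i : ι} (hi : i ∉ J) :
    (Ideal.span (x '' J)).colon {x i} ≤ colonSup x i :=
  le_sup_of_le_left <| Submodule.colon_mono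
    (Ideal.span_mono (Set.image_mono (Set.subset_compl_singleton_iff.mpr hi))) subset_rfl

theorem colonSup_comp_perm (x : ι → R) (σ : Equiv.Perm ι) (i : ι) :
    colonSup (x ∘ σ) i = colonSup x (σ i) := by
  rw [colonSup, colonSup, σ.surjective.range_comp, Set.image_comp, Equiv.image_compl,
    Set.image_singleton, Function.comp_apply]

theorem mul_prod_mem_span_powOn_two {x : ι → R} {S E : Set ι} {T : Finset ι} (hT : S ∩ E ⊆ T)
    {b : R} (hb : b ∈ Ideal.span (x '' S)) :
    b * ∏ l ∈ T, x l ∈ Ideal.span (powOn x E 2 '' S) := by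
  classical
  rw [← mem_colon_singleton_iff_mul_mem]
  revert b
  rw [← SetLike.le_def, Ideal.span_le]
  rintro _ ⟨m, hm, rfl⟩
  have hmem : powOn x E 2 m ∈ Ideal.span (powOn x E 2 '' S) := Ideal.subset_span ⟨m, hm, rfl⟩
  rw [SetLike.mem_coe, mem_colon_singleton_iff_mul_mem]
  by_cases hmE : m ∈ E
  · rw [powOn_of_mem hmE, sq] at hmem
    rw [← Finset.mul_prod_erase _ _ (hT ⟨hm, hmE⟩), ← mul_assoc]
    exact Ideal.mul_mem_right _ _ hmem
  · rw [powOn_of_notMem hmE] at hmem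
    exact Ideal.mul_mem_right _ _ hmem

theorem mul_prod_mem_of_mem_colonSup {x : ι → R} {J : Finset ι} {j : ι} (hj : j ∈ J) {a : R}
    (ha : a ∈ colonSup x j) :
    a * ∏ l ∈ J, x l ∈ Ideal.span (Set.range (powOn x J 2)) := by
  classical
  obtain ⟨u, hu, q, hq, rfl⟩ := Submodule.mem_sup.mp ha
  rw [mem_colon_singleton_iff_mul_mem] at hu
  rw [← Set.image_univ] at hq ⊢
  rw [add_mul]
  refine add_mem ?_ (mul_prod_mem_span_powOn_two Set.inter_subset_right hq)
  rw [← Finset.mul_prod_erase _ _ hj, ← mul_assoc]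
  refine Ideal.span_mono (Set.image_mono (Set.subset_univ {j}ᶜ))
    (mul_prod_mem_span_powOn_two (fun m hm => ?_) hu)
  exact Finset.mem_erase.mpr hm

variable {d : ℕ} (x : Fin d → R)

theorem span_range_le_limitClosure : Ideal.span (Set.range x) ≤ limitClosure x :=
  fun _ ha => ⟨0, by simpa using ha⟩

theorem colonSup_le_limitClosure (i : Fin d) : colonSup x i ≤ limitClosure x := fun a ha =>
  ⟨1, by simpa [powOn_univ] using mul_prod_mem_of_mem_colonSup (Finset.mem_univ i) ha⟩

end ColonSup

/-! ### Colon ideals of parameters in Buchsbaum rings -/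

section BuchsbaumColon

variable {R : Type*} [CommRing R] [IsLocalRing R]

theorem IsSystemOfParameters.update_add {d : ℕ} {x : Fin d → R} (hx : IsSystemOfParameters x)
    {i : Fin d} {b : R} (hb : b ∈ (Ideal.span (x '' {i}ᶜ)).radical) :
    IsSystemOfParameters (Function.update x i (x i + b)) := by
  have hle : Ideal.span (x '' {i}ᶜ) ≤ Ideal.span (Set.range (Function.update x i (x i + b))) :=
    span_range_update x i (x i + b) ▸ le_sup_left
  have hbm : b ∈ IsLocalRing.maximalIdeal R :=
    hx.2 ▸ Ideal.radical_mono (Ideal.span_mono (Set.image_subset_range _ _)) hb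
  refine hx.of_mem_radical (fun k => ?_) fun k => ?_
  · obtain rfl | hk := eq_or_ne k i
    · simpa using add_mem (hx.mem_maximalIdeal k) hbm
    · simpa [hk] using hx.mem_maximalIdeal k
  · obtain rfl | hk := eq_or_ne k i
    · have hsum : x k + b ∈
          (Ideal.span (Set.range (Function.update x k (x k + b)))).radical :=
        Ideal.le_radical (Ideal.subset_span ⟨k, Function.update_self ..⟩)
      simpa using sub_mem hsum (Ideal.radical_mono hle hb)
    · exact Ideal.le_radical (hle (Ideal.subset_span ⟨k, hk, rfl⟩))

variable [IsNoetherianRing R]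

theorem mem_of_forall_mem_sup_maximalIdeal_pow {P : Ideal R} {b : R}
    (h : ∀ n, b ∈ P ⊔ IsLocalRing.maximalIdeal R ^ n) : b ∈ P := by
  rw [← Submodule.Quotient.mk_eq_zero P]
  refine IsHausdorff.haus (I := IsLocalRing.maximalIdeal R) inferInstance _ fun n => ?_
  obtain ⟨p, hp, q, hq, rfl⟩ := Submodule.mem_sup.mp (h n)
  rw [SModEq.zero, Submodule.Quotient.mk_add, (Submodule.Quotient.mk_eq_zero P).mpr hp, zero_add,
    ← mul_one q, ← smul_eq_mul, Submodule.Quotient.mk_smul]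
  exact Submodule.smul_mem_smul hq Submodule.mem_top

variable {d : ℕ} {x : Fin d → R}

theorem mem_span_image_of_forall_mem_powOn (hx : IsSystemOfParameters x) {J : Set (Fin d)}
    {i : Fin d} {b : R}
    (h : ∀ n, 0 < n → b ∈ Ideal.span (powOn x (insert i J)ᶜ n '' {i}ᶜ)) :
    b ∈ Ideal.span (x '' J) := by
  refine mem_of_forall_mem_sup_maximalIdeal_pow fun n => ?_
  refine (Ideal.span_le.mpr ?_ : Ideal.span (powOn x (insert i J)ᶜ (n + 1) '' {i}ᶜ) ≤ _)
    (h (n + 1) n.succ_pos)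
  rintro _ ⟨j, hji, rfl⟩
  by_cases hj : j ∈ J
  · rw [powOn_of_notMem (by simp [hj])]
    exact Ideal.mem_sup_left (Ideal.subset_span ⟨j, hj, rfl⟩)
  · rw [powOn_of_mem (by grind)]
    exact Ideal.mem_sup_right (Ideal.pow_le_pow_right n.le_succ
      (Ideal.pow_mem_pow (hx.mem_maximalIdeal j) _))

namespace IsBuchsbaum

variable (hB : IsBuchsbaum R) (hx : IsSystemOfParameters x)
include hB hx

theorem colon_pow_le_colon {J : Set (Fin d)} {i : Fin d} (hi : i ∉ J) (n : ℕ) :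
    (Ideal.span (x '' J)).colon {x i ^ n} ≤ (Ideal.span (x '' J)).colon {x i} := by
  intro a ha
  rw [mem_colon_singleton_iff_mul_mem] at ha ⊢
  refine mem_span_image_of_forall_mem_powOn hx (i := i) fun t ht => ?_
  have hle := hB.colon_pow_le_colon_compl (hx.powOn (insert i J)ᶜ ht) i n
  rw [powOn_of_notMem (by simp)] at hle
  exact mem_colon_singleton_iff_mul_mem.mp
    (hle (mem_colon_singleton_iff_mul_mem.mpr (span_image_le_span_powOn hi t ha)))

-- If `a * x i` lies in `P`, generated by the `x k` with `k ∈ J` and by `n`-th powers of the others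
-- including `x j ^ n`, then `a * (x i + x j) ^ n ∈ P`, and `x i + x j` may take the place of `x i`.
theorem colon_le_colon {J : Set (Fin d)} {i j : Fin d} (hi : i ∉ J) (hj : j ∉ J) :
    (Ideal.span (x '' J)).colon {x i} ≤ (Ideal.span (x '' J)).colon {x j} := by
  obtain rfl | hij := eq_or_ne j i
  · exact le_rfl
  intro a ha
  rw [mem_colon_singleton_iff_mul_mem] at ha ⊢
  refine mem_span_image_of_forall_mem_powOn hx (i := i) fun n hn => ?_
  have hy := hx.powOn (insert i J)ᶜ hn
  have hai := span_image_le_span_powOn hi n ha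
  have hj_mem : x j ^ n ∈ Ideal.span (powOn x (insert i J)ᶜ n '' {i}ᶜ) :=
    Ideal.subset_span ⟨j, hij, powOn_of_mem (by grind)⟩
  have hyi : powOn x (insert i J)ᶜ n i = x i := powOn_of_notMem (by simp)
  set y := powOn x (insert i J)ᶜ n
  set P := Ideal.span (y '' {i}ᶜ) with hP
  have hz := hy.update_add (Ideal.mem_radical_of_pow_mem (Ideal.le_radical hj_mem))
  have hle := hB.colon_pow_le_colon_compl hz i n
  rw [image_update_of_notMem y (J := {i}ᶜ) (by simp), Function.update_self, hyi, ← hP] at hle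
  have hpow : a * (x i + x j) ^ n ∈ P := by
    obtain ⟨q, hq⟩ := sub_dvd_pow_sub_pow (x i + x j) (x j) n
    rw [add_sub_cancel_right] at hq
    rw [show a * (x i + x j) ^ n = q * (a * x i) + a * x j ^ n by linear_combination a * hq]
    exact add_mem (Ideal.mul_mem_left _ _ hai) (Ideal.mul_mem_left _ _ hj_mem)
  have hsum := mem_colon_singleton_iff_mul_mem.mp (hle (mem_colon_singleton_iff_mul_mem.mpr hpow))
  rw [mul_add] at hsum
  exact (Submodule.add_mem_iff_right _ hai).mp hsum

theorem colon_inf_span_image_union_le {J : Set (Fin d)} {i : Fin d} (hi : i ∉ J)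
    (K : Finset (Fin d)) :
    (Ideal.span (x '' J)).colon {x i} ⊓ Ideal.span (x '' (J ∪ K)) ≤ Ideal.span (x '' J) := by
  induction K using Finset.induction_on with
  | empty => simp
  | insert l K _ ih =>
    rintro a ⟨ha, haK⟩
    refine ih ⟨ha, ?_⟩
    rw [Finset.coe_insert, Set.union_insert] at haK
    by_cases hl : l ∈ J ∪ K
    · rwa [Set.insert_eq_of_mem hl] at haK
    rw [SetLike.mem_coe, span_image_insert, mem_sup_span_singleton] at haK
    obtain ⟨r, hr⟩ := haK
    have hal : a * x l ∈ Ideal.span (x '' (J ∪ K)) :=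
      Ideal.span_mono (Set.image_mono Set.subset_union_left) (mem_colon_singleton_iff_mul_mem.mp
        (hB.colon_le_colon hx hi (fun h => hl (.inl h)) ha))
    have hrl : r * x l ^ 2 ∈ Ideal.span (x '' (J ∪ K)) := by
      rw [show r * x l ^ 2 = a * x l - (a - r * x l) * x l by ring]
      exact sub_mem hal (Ideal.mul_mem_right _ _ hr)
    have hr' := hB.colon_pow_le_colon hx hl 2 (mem_colon_singleton_iff_mul_mem.mpr hrl)
    simpa using add_mem hr (mem_colon_singleton_iff_mul_mem.mp hr')

theorem colon_inf_span_range_le {J : Set (Fin d)} {i : Fin d} (hi : i ∉ J) :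
    (Ideal.span (x '' J)).colon {x i} ⊓ Ideal.span (Set.range x) ≤ Ideal.span (x '' J) := by
  simpa using hB.colon_inf_span_image_union_le hx hi Finset.univ

theorem colength_colonSup (i : Fin d) : colength (colonSup x i) = paramMult x := by
  rw [colonSup_eq, ← hB.colength_colon_pow_sup hx i 0, zero_add, pow_one]

-- For `v` in the left-hand side, `v * x j` lies in
-- `((P, x_j²) : x_i) ∩ (P, x_j², x_i) = (P, x_j²)`, where the remaining parameters generate `P`.
theorem colon_inf_colon_le {i j : Fin d} (hij : i ≠ j) :
    (Ideal.span (x '' {i}ᶜ)).colon {x i} ⊓ (Ideal.span (x '' {j}ᶜ)).colon {x j} ≤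
      (Ideal.span (x '' {i, j}ᶜ)).colon {x j} ⊔ Ideal.span {x j} := by
  rintro v ⟨hvi, hvj⟩
  rw [SetLike.mem_coe, mem_colon_singleton_iff_mul_mem, span_image_compl_singleton x hij] at hvi
  rw [SetLike.mem_coe, mem_colon_singleton_iff_mul_mem, span_image_compl_singleton x hij.symm,
    Set.pair_comm] at hvj
  set P := Ideal.span (x '' {i, j}ᶜ) with hP
  have hy := hx.powOn {j} two_pos
  have hyi : powOn x {j} 2 i = x i := powOn_of_notMem hij
  have hspan : Ideal.span (powOn x {j} 2 '' {i}ᶜ) = P ⊔ Ideal.span {x j ^ 2} := by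
    rw [span_image_compl_singleton _ hij, powOn_of_mem (Set.mem_singleton j),
      image_powOn_of_disjoint (by simp), hP]
  have hmem : v * x j ∈ P ⊔ Ideal.span {x j ^ 2} := by
    rw [← hspan]
    refine hB.colon_inf_span_range_le hy (i := i) (by simp) ⟨?_, ?_⟩
    · obtain ⟨r, hr⟩ := mem_sup_span_singleton.mp hvi
      rw [SetLike.mem_coe, mem_colon_singleton_iff_mul_mem, hspan, hyi, mem_sup_span_singleton]
      exact ⟨r, by simpa [sub_mul, sq, mul_assoc, mul_comm (x i)] using P.mul_mem_right (x j) hr⟩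
    · rw [SetLike.mem_coe, span_range_eq_sup _ i, hspan, hyi]
      exact sup_le_sup_right (le_sup_left : P ≤ P ⊔ _) _ hvj
  obtain ⟨r, hr⟩ := mem_sup_span_singleton.mp hmem
  refine mem_sup_span_singleton.mpr ⟨r, mem_colon_singleton_iff_mul_mem.mpr ?_⟩
  rwa [sub_mul, mul_assoc, ← sq]

theorem colonSup_inf_le {i j : Fin d} (hij : i ≠ j) :
    colonSup x i ⊓ colonSup x j ≤
      (Ideal.span (x '' {i, j}ᶜ)).colon {x j} ⊔ Ideal.span (Set.range x) := by
  have hle (k : Fin d) : Ideal.span {x k} ≤ Ideal.span (Set.range x) :=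
    span_range_eq_sup x k ▸ le_sup_right
  have hj_le : Ideal.span {x j} ≤ (Ideal.span (x '' {i}ᶜ)).colon {x i} :=
    (span_image_compl_singleton x hij ▸ le_sup_right).trans Ideal.le_colon
  have hi_le : Ideal.span {x i} ≤ (Ideal.span (x '' {j}ᶜ)).colon {x j} :=
    (span_image_compl_singleton x hij.symm ▸ le_sup_right).trans Ideal.le_colon
  rw [colonSup_eq, colonSup_eq, sup_comm, sup_inf_assoc_of_le _ (le_sup_of_le_left hi_le), inf_comm,
    sup_comm _ (Ideal.span {x j}), sup_inf_assoc_of_le _ hj_le, inf_comm]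
  exact sup_le (le_sup_of_le_right (hle i)) (sup_le (le_sup_of_le_right (hle j))
    ((hB.colon_inf_colon_le hx hij).trans (sup_le_sup_left (hle j) _)))

end IsBuchsbaum

theorem IsBuchsbaum.colength_colonSup_sup_le (hB : IsBuchsbaum R) {D : ℕ} {x : Fin (D + 2) → R}
    (hx : IsSystemOfParameters x) :
    colength (colonSup x 0 ⊔ colonSup x 1) ≤ hilbertCoeff (Ideal.span (Set.range x)) 0 +
      hilbertCoeff (Ideal.span (Set.range x)) 1 := by
  have hIoi_zero : Set.Ioi (0 : Fin (D + 2)) = {0}ᶜ := by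
    ext j; simp [Fin.pos_iff_ne_zero]
  have hIoi_one : Set.Ioi (1 : Fin (D + 2)) = {0, 1}ᶜ := by
    ext j
    simp only [Set.mem_Ioi, Set.mem_compl_iff, Set.mem_insert_iff, Set.mem_singleton_iff,
      Fin.lt_def, Fin.ext_iff, Fin.val_zero, Fin.val_one]
    omega
  have hfin : IsFiniteLength R (R ⧸ (colonSup x 0 ⊓ colonSup x 1)) :=
    isFiniteLength_quotient_of_le hx.isFiniteLength_quotient (le_inf le_sup_right le_sup_right)
  have hzero := hB.colength_colonSup hx 0
  have hone := hB.colength_colonSup hx 1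
  have hinf := colength_mono hfin (hB.colonSup_inf_le hx (Fin.zero_ne_one : (0 : Fin (D + 2)) ≠ 1))
  have hadd := colength_inf_add_colength_sup hfin
  have hbound := hx.hilbertCoeff_zero_sub_le_hilbertCoeff_one (by rwa [hIoi_zero])
  rw [hIoi_one] at hbound
  linarith

end BuchsbaumColon

/-! ### Families that are regular in any order -/

section RegularModFewer

variable {R ι : Type*} [CommRing R] {x : ι → R} {k : ℕ}

/-- Each `x i` is a nonzerodivisor modulo the ideal generated by any fewer than `k` other members of
the family. For `k` larger than the number of members, `x` is a weakly regular sequence in any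
order. -/
def IsRegularModFewer (x : ι → R) (k : ℕ) : Prop :=
  ∀ J : Finset ι, J.card < k → ∀ i ∉ J,
    (Ideal.span (x '' J)).colon {x i} ≤ Ideal.span (x '' J)

namespace IsRegularModFewer

theorem mem (h : IsRegularModFewer x k) {J : Finset ι} (hJ : J.card < k) {i : ι} (hi : i ∉ J)
    {a : R} (ha : a * x i ∈ Ideal.span (x '' J)) : a ∈ Ideal.span (x '' J) :=
  h J hJ i hi (mem_colon_singleton_iff_mul_mem.mpr ha)

section Update

variable [DecidableEq ι]

theorem mem_of_update {b : R} {l : ι} (h : IsRegularModFewer (Function.update x l b) k)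
    {J : Finset ι} (hJ : J.card < k) (hl : l ∉ J) {a : R} (ha : a * b ∈ Ideal.span (x '' J)) :
    a ∈ Ideal.span (x '' J) := by
  rw [← image_update_of_notMem x hl b] at ha ⊢
  exact h.mem hJ hl (by rwa [Function.update_self])

theorem span_update_image (x : ι → R) {l : ι} {J : Finset ι} (hl : l ∈ J) (b : R) :
    Ideal.span (Function.update x l b '' J) = Ideal.span (x '' (J.erase l)) ⊔ Ideal.span {b} := by
  rw [← Finset.insert_erase hl, Finset.coe_insert, span_image_insert, Function.update_self,
    image_update_of_notMem x (by simp), Finset.erase_insert (Finset.notMem_erase l J)]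

theorem update_mul {b c : R} {l : ι} (hb : IsRegularModFewer (Function.update x l b) k)
    (hc : IsRegularModFewer (Function.update x l c) k) :
    IsRegularModFewer (Function.update x l (b * c)) k := by
  intro J hJ i hi a ha
  rw [mem_colon_singleton_iff_mul_mem] at ha
  by_cases hl : l ∈ J
  · have hil : i ≠ l := (ne_of_mem_of_not_mem hl hi).symm
    have hJl : (J.erase l).card < k := (Finset.card_erase_lt_of_mem hl).trans hJ
    have hb_mem {a : R} := hb.mem (a := a) hJ hi
    have hc_mem {a : R} := hc.mem (a := a) hJ hi
    have hb_erase {a : R} := hb.mem_of_update (a := a) hJl (Finset.notMem_erase l J)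
    simp only [Function.update_of_ne hil, span_update_image x hl, mem_sup_span_singleton] at *
    obtain ⟨r, hr⟩ := ha
    obtain ⟨t, ht⟩ := hb_mem (a := a) ⟨r * c, by rwa [mul_assoc, mul_comm c]⟩
    have hmul : t * x i - r * c ∈ Ideal.span (x '' (J.erase l)) := by
      refine hb_erase ?_
      rw [show (t * x i - r * c) * b = a * x i - r * (b * c) - (a - t * b) * x i by ring]
      exact sub_mem hr (Ideal.mul_mem_right _ _ ht)
    obtain ⟨s, hs⟩ := hc_mem ⟨r, hmul⟩
    refine ⟨s, ?_⟩
    rw [show a - s * (b * c) = a - t * b + (t - s * c) * b by ring]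
    exact add_mem ht (Ideal.mul_mem_right _ _ hs)
  · rw [image_update_of_notMem x hl] at ha ⊢
    obtain rfl | hil := eq_or_ne i l
    · rw [Function.update_self, mul_comm b, ← mul_assoc] at ha
      exact hc.mem_of_update hJ hl (hb.mem_of_update hJ hl ha)
    · rw [← image_update_of_notMem x hl b] at ha ⊢
      rw [Function.update_of_ne hil] at ha
      exact hb.mem hJ hi (by rwa [Function.update_of_ne hil])

theorem update_pow (h : IsRegularModFewer x k) (l : ι) {n : ℕ} (hn : 0 < n) :
    IsRegularModFewer (Function.update x l (x l ^ n)) k := by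
  induction n, Nat.succ_le_of_lt hn using Nat.le_induction with
  | base => simpa using h
  | succ n hpos ih => exact pow_succ (x l) n ▸ (ih hpos).update_mul (by simpa using h)

end Update

theorem powOn (h : IsRegularModFewer x k) (E : Finset ι) {n : ℕ} (hn : 0 < n) :
    IsRegularModFewer (powOn x E n) k := by
  classical
  induction E using Finset.induction_on with
  | empty => simpa [powOn_empty] using h
  | insert l E hl ih =>
    rw [Finset.coe_insert, powOn_insert hl]
    exact ih.update_pow l hn

theorem mem_span_of_mul_prod_mem (h : IsRegularModFewer x k) {J E : Finset ι} (hJ : J.card ≤ k)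
    (hE : E ⊆ J) {a : R} (ha : a * ∏ l ∈ E, x l ∈ Ideal.span (_root_.powOn x E 2 '' J)) :
    a ∈ Ideal.span (x '' J) := by
  classical
  induction E using Finset.induction_on with
  | empty => simpa [powOn_empty] using ha
  | insert l E hl ih =>
    have hlJ : l ∈ J := hE (Finset.mem_insert_self l E)
    have hxl : _root_.powOn x E 2 l = x l := powOn_of_notMem hl
    refine ih ((Finset.subset_insert l E).trans hE) ?_
    rw [Finset.prod_insert hl, Finset.coe_insert, powOn_insert hl, span_update_image _ hlJ, hxl,
      mem_sup_span_singleton] at ha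
    obtain ⟨r, hr⟩ := ha
    rw [← Function.update_eq_self l (_root_.powOn x E 2), span_update_image _ hlJ, hxl,
      mem_sup_span_singleton]
    refine ⟨r, (h.powOn E two_pos).mem ((Finset.card_erase_lt_of_mem hlJ).trans_le hJ)
      (Finset.notMem_erase l J) ?_⟩
    rwa [hxl, show (a * ∏ m ∈ E, x m - r * x l) * x l = a * (x l * ∏ m ∈ E, x m) - r * x l ^ 2 by
      ring]

end IsRegularModFewer

end RegularModFewer

/-! ### The inequality and its case of equality -/

section LimitClosure

variable {R : Type*} [CommRing R] [IsLocalRing R]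

theorem IsSystemOfParameters.comp_perm {d : ℕ} {x : Fin d → R} (hx : IsSystemOfParameters x)
    (σ : Equiv.Perm (Fin d)) : IsSystemOfParameters (x ∘ σ) := by
  rw [IsSystemOfParameters, σ.surjective.range_comp]
  exact hx

namespace IsBuchsbaum

variable [IsNoetherianRing R] (hB : IsBuchsbaum R)
include hB

theorem colength_limitClosure_le {D : ℕ} {x : Fin (D + 2) → R} (hx : IsSystemOfParameters x) :
    colength (limitClosure x) ≤
      hilbertCoeff (Ideal.span (Set.range x)) 0 + hilbertCoeff (Ideal.span (Set.range x)) 1 :=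
  (colength_mono
    (isFiniteLength_quotient_of_le hx.isFiniteLength_quotient (le_sup_of_le_left le_sup_right))
    (sup_le (colonSup_le_limitClosure x 0) (colonSup_le_limitClosure x 1))).trans
    (hB.colength_colonSup_sup_le hx)

theorem limitClosure_le_colonSup_sup {D : ℕ} {x : Fin (D + 2) → R} (hx : IsSystemOfParameters x)
    (heq : hilbertCoeff (Ideal.span (Set.range x)) 0 + hilbertCoeff (Ideal.span (Set.range x)) 1 =
      colength (limitClosure x)) {i j : Fin (D + 2)} (hij : i ≠ j) :
    limitClosure x ≤ colonSup x i ⊔ colonSup x j := by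
  obtain ⟨σ, hσi, hσj⟩ : ∃ σ : Equiv.Perm (Fin (D + 2)), σ 0 = i ∧ σ 1 = j :=
    MulAction.is_two_pretransitive_iff.mp
      (Equiv.Perm.isMultiplyPretransitive (Fin (D + 2)) 2) Fin.zero_ne_one hij
  have hle := hB.colength_colonSup_sup_le (hx.comp_perm σ)
  rw [σ.surjective.range_comp, heq, colonSup_comp_perm, colonSup_comp_perm, hσi, hσj] at hle
  have hfin : IsFiniteLength R (R ⧸ (colonSup x i ⊔ colonSup x j)) :=
    isFiniteLength_quotient_of_le hx.isFiniteLength_quotient (le_sup_of_le_left le_sup_right)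
  exact (eq_of_le_of_colength_le hfin
    (sup_le (colonSup_le_limitClosure x i) (colonSup_le_limitClosure x j)) hle).ge

theorem isRegularModFewer {d : ℕ} {x : Fin d → R} (hx : IsSystemOfParameters x)
    (hlim : ∀ i j, i ≠ j → limitClosure x ≤ colonSup x i ⊔ colonSup x j)
    (hreg : IsRegularModFewer x 2) (k : ℕ) : IsRegularModFewer x k := by
  induction k with
  | zero => exact fun _ hJ => absurd hJ (Nat.not_lt_zero _)
  | succ k ih =>
    intro J hJ i hi a ha
    obtain hcard | hcard := lt_or_ge J.card 2
    · exact hreg J hcard i hi ha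
    obtain ⟨j, hj, l, hl, hjl⟩ := Finset.one_lt_card.mp hcard
    have hprod : a * ∏ m ∈ J, x m ∈ Ideal.span (Set.range (powOn x J 2)) := by
      obtain ⟨u, hu, v, hv, rfl⟩ := Submodule.mem_sup.mp
        (hlim j l hjl (colonSup_le_limitClosure x i (colon_le_colonSup x hi ha)))
      rw [add_mul]
      exact add_mem (mul_prod_mem_of_mem_colonSup hj hu) (mul_prod_mem_of_mem_colonSup hl hv)
    refine ih.mem_span_of_mul_prod_mem (Nat.le_of_lt_succ hJ) subset_rfl
      (hB.colon_inf_span_range_le (hx.powOn J two_pos) hi ⟨?_, hprod⟩)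
    rw [SetLike.mem_coe, mem_colon_singleton_iff_mul_mem, powOn_of_notMem hi, mul_right_comm]
    exact mul_prod_mem_span_powOn_two Set.inter_subset_left (mem_colon_singleton_iff_mul_mem.mp ha)

end IsBuchsbaum

end LimitClosure

/-! ### Depth at most two -/

section Depth

open RingTheory.Sequence
open scoped Pointwise

variable {R : Type*} [CommRing R]

theorem dvd_of_dvd_mul_of_isWeaklyRegular_pair {u v y a : R} (h : IsWeaklyRegular R [u, v])
    (hy : IsSMulRegular R y) (hu : y ∣ a * u) (hv : y ∣ a * v) : y ∣ a := by
  obtain ⟨hu_reg, hv_reg⟩ := (isWeaklyRegular_cons_iff R u [v]).mp h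
  obtain ⟨b, hb⟩ := hu
  obtain ⟨c, hc⟩ := hv
  have hbc : v * b = u * c := hy (show y * (v * b) = y * (u * c) by
    linear_combination u * hc - v * hb)
  have hb_mem : b ∈ u • (⊤ : Submodule R R) :=
    mem_of_isSMulRegular_quotient_of_smul_mem ((isWeaklyRegular_singleton_iff _ v).mp hv_reg)
      (show v * b ∈ _ from hbc ▸ Submodule.smul_mem_pointwise_smul c u ⊤ trivial)
  obtain ⟨q, -, rfl⟩ := Submodule.mem_smul_pointwise_iff_exists _ _ _ |>.mp hb_mem
  exact ⟨q, hu_reg (show u * a = u * (y * q) by rw [smul_eq_mul] at hb; linear_combination hb)⟩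

variable [IsLocalRing R]

theorem exists_isWeaklyRegular_of_le_localDepth {n : ℕ} (h : n ≤ localDepth R) :
    ∃ rs : List R, rs.length = n ∧ (∀ r ∈ rs, r ∈ IsLocalRing.maximalIdeal R) ∧
      IsWeaklyRegular R rs := by
  obtain _ | n := n
  · exact ⟨[], rfl, by simp, .nil R R⟩
  obtain ⟨rs, ⟨hmem, hreg⟩, hlen⟩ : ∃ rs ∈ {rs : List R |
      (∀ r ∈ rs, r ∈ IsLocalRing.maximalIdeal R) ∧ IsRegular R rs}, (n : ℕ∞) < rs.length := by
    simpa only [localDepth, lt_iSup_iff, exists_prop] using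
      (Nat.cast_lt.mpr n.lt_succ_self).trans_le h
  refine ⟨rs.take (n + 1), ?_, fun r hr => hmem r (List.mem_of_mem_take hr), ?_⟩
  · exact List.length_take_of_le (Nat.cast_lt.mp hlen)
  · have := hreg.toIsWeaklyRegular
    rw [← List.take_append_drop (n + 1) rs, isWeaklyRegular_append_iff] at this
    exact this.1

theorem exists_isSMulRegular_mem_maximalIdeal_pow (h : 1 ≤ localDepth R) (N : ℕ) :
    ∃ u ∈ IsLocalRing.maximalIdeal R ^ N, IsSMulRegular R u := by
  obtain ⟨rs, hlen, hmem, hreg⟩ := exists_isWeaklyRegular_of_le_localDepth (n := 1) (by simpa)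
  obtain ⟨r, rfl⟩ := List.length_eq_one_iff.mp hlen
  exact ⟨r ^ N, Ideal.pow_mem_pow (hmem r (by simp)) N,
    ((isWeaklyRegular_singleton_iff R r).mp hreg).pow N⟩

variable [IsNoetherianRing R]

theorem exists_isWeaklyRegular_pair_mem_maximalIdeal_pow (h : 2 ≤ localDepth R) (N : ℕ) :
    ∃ u ∈ IsLocalRing.maximalIdeal R ^ N, ∃ v ∈ IsLocalRing.maximalIdeal R ^ N,
      IsWeaklyRegular R [u, v] := by
  obtain ⟨rs, hlen, hmem, hreg⟩ := exists_isWeaklyRegular_of_le_localDepth (n := 2) (by simpa)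
  obtain ⟨r, s, rfl⟩ := List.length_eq_two.mp hlen
  obtain rfl | hN := N.eq_zero_or_pos
  · exact ⟨r, by simp, s, by simp, hreg⟩
  have hr : r ∈ IsLocalRing.maximalIdeal R := hmem r (by simp)
  have hs : s ∈ IsLocalRing.maximalIdeal R := hmem s (by simp)
  have hsN := Ideal.pow_mem_of_mem _ hs N hN
  -- Powers of the last element cost nothing; a permutation makes the other element the last one.
  have hpow {a b : R} (hab : IsWeaklyRegular R [a, b]) : IsWeaklyRegular R [a, b ^ N] := by
    rw [isWeaklyRegular_cons_iff, isWeaklyRegular_singleton_iff] at hab ⊢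
    exact ⟨hab.1, hab.2.pow N⟩
  have hswap : IsWeaklyRegular R [s ^ N, r] :=
    IsLocalRing.isWeaklyRegular_of_perm_of_subset_maximalIdeal (hpow hreg) (.swap _ _ _)
      (by simpa using ⟨hr, hsN⟩)
  exact ⟨s ^ N, Ideal.pow_mem_pow hs N, r ^ N, Ideal.pow_mem_pow hr N, hpow hswap⟩

namespace IsBuchsbaum

variable (hB : IsBuchsbaum R) {d : ℕ} {x : Fin d → R}
include hB

theorem exists_forall_mul_mem (hx : IsSystemOfParameters x) {J : Set (Fin d)} {i : Fin d}
    (hi : i ∉ J) {a : R} (ha : a ∈ (Ideal.span (x '' J)).colon {x i}) :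
    ∃ N, ∀ b ∈ IsLocalRing.maximalIdeal R ^ N, a * b ∈ Ideal.span (x '' J) := by
  obtain ⟨N, hN⟩ := hx.exists_pow_le
  refine ⟨N, fun b hb => ?_⟩
  have hle : Ideal.span (Set.range x) ≤ (Ideal.span (x '' J)).colon {a} := by
    rw [Ideal.span_le]
    rintro _ ⟨j, rfl⟩
    rw [SetLike.mem_coe, mem_colon_singleton_iff_mul_mem]
    by_cases hj : j ∈ J
    · exact Ideal.mul_mem_right _ _ (Ideal.subset_span ⟨j, hj, rfl⟩)
    · exact mul_comm a _ ▸ mem_colon_singleton_iff_mul_mem.mp (hB.colon_le_colon hx hi hj ha)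
  exact mul_comm b a ▸ mem_colon_singleton_iff_mul_mem.mp (hle (hN hb))

theorem isSMulRegular (hx : IsSystemOfParameters x) (h : 1 ≤ localDepth R) (i : Fin d) :
    IsSMulRegular R (x i) := by
  refine isSMulRegular_iff_right_eq_zero_of_smul.mpr fun a ha => ?_
  obtain ⟨N, hN⟩ := hB.exists_forall_mul_mem hx (Set.notMem_empty i) (a := a)
    (mem_colon_singleton_iff_mul_mem.mpr (by simpa [mul_comm a] using ha))
  obtain ⟨u, hu, hreg⟩ := exists_isSMulRegular_mem_maximalIdeal_pow h N
  exact hreg.right_eq_zero_of_smul (by simpa [mul_comm a] using hN u hu)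

theorem isRegularModFewer_one (hx : IsSystemOfParameters x) (h : 1 ≤ localDepth R) :
    IsRegularModFewer x 1 := by
  intro J hJ i _ a ha
  obtain rfl := Finset.card_eq_zero.mp (Nat.lt_one_iff.mp hJ)
  simp only [Finset.coe_empty, Set.image_empty, Ideal.span_empty, Ideal.mem_bot,
    mem_colon_singleton_iff_mul_mem, mul_comm a] at ha ⊢
  exact (hB.isSMulRegular hx h i).right_eq_zero_of_smul ha

theorem isRegularModFewer_two (hx : IsSystemOfParameters x) (h : 2 ≤ localDepth R) :
    IsRegularModFewer x 2 := by
  have hone : 1 ≤ localDepth R := one_le_two.trans h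
  intro J hJ i hi a ha
  obtain hcard | hcard := (Nat.lt_succ_iff.mp hJ).lt_or_eq
  · exact hB.isRegularModFewer_one hx hone J hcard i hi ha
  obtain ⟨j, rfl⟩ := Finset.card_eq_one.mp hcard
  obtain ⟨N, hN⟩ := hB.exists_forall_mul_mem hx (by exact_mod_cast hi) ha
  obtain ⟨u, hu, v, hv, huv⟩ := exists_isWeaklyRegular_pair_mem_maximalIdeal_pow h N
  simp only [Finset.coe_singleton, Set.image_singleton, Ideal.mem_span_singleton] at hN ⊢
  exact dvd_of_dvd_mul_of_isWeaklyRegular_pair huv (hB.isSMulRegular hx hone j) (hN u hu) (hN v hv)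

end IsBuchsbaum

end Depth

/-! ### Cohen–Macaulay rings -/

section CohenMacaulay

open RingTheory.Sequence

variable {R : Type*} [CommRing R] [IsLocalRing R]

theorem localDepth_le_ringKrullDim [IsNoetherianRing R] :
    (localDepth R : WithBot ℕ∞) ≤ ringKrullDim R := by
  obtain ⟨n, hn⟩ := WithBot.ne_bot_iff_exists.mp (ringKrullDim_ne_bot (R := R))
  rw [← hn, WithBot.coe_le_coe]
  refine iSup₂_le fun rs ⟨_, hrs⟩ => ?_
  have hne : Ideal.ofList rs ≠ ⊤ := fun h => hrs.top_ne_smul (by rw [h]; simp)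
  have : Nontrivial (R ⧸ Ideal.ofList rs) := Ideal.Quotient.nontrivial_iff.mpr hne
  rw [← WithBot.coe_le_coe, hn, ← ringKrullDim_add_length_eq_ringKrullDim_of_isRegular rs hrs]
  exact le_add_of_nonneg_left ringKrullDim_nonneg_of_nontrivial

theorem IsRegularModFewer.isWeaklyRegular_ofFn {R : Type*} [CommRing R] {d : ℕ} {x : Fin d → R}
    (h : IsRegularModFewer x d) : IsWeaklyRegular R (List.ofFn x) := by
  refine ⟨fun i hi => ?_⟩
  have hid : i < d := by simpa using hi
  have hspan : Ideal.ofList ((List.ofFn x).take i) =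
      Ideal.span (x '' (Finset.Iio (⟨i, hid⟩ : Fin d) : Finset (Fin d))) := by
    refine congrArg Ideal.span (Set.ext fun r => ?_)
    simp only [List.mem_take_iff_getElem, Set.mem_ofPred_eq, List.getElem_ofFn, List.length_ofFn,
      Set.mem_image, Finset.coe_Iio, Set.mem_Iio, Fin.exists_iff, Fin.lt_def, lt_min_iff]
    grind
  rw [smul_eq_mul, Ideal.mul_top, hspan, List.getElem_ofFn,
    isSMulRegular_quotient_iff_mem_of_smul_mem]
  refine fun a ha => h.mem (i := ⟨i, hid⟩) (by simpa using hid) (by simp) ?_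
  rwa [mul_comm, ← smul_eq_mul]

theorem IsSystemOfParameters.isCohenMacaulayLocal [IsNoetherianRing R] {d : ℕ} {x : Fin d → R}
    (hx : IsSystemOfParameters x) (hreg : IsRegularModFewer x d) : IsCohenMacaulayLocal R := by
  have hmem : ∀ r ∈ List.ofFn x, r ∈ IsLocalRing.maximalIdeal R :=
    List.forall_mem_ofFn_iff.mpr hx.mem_maximalIdeal
  have hle : ((List.ofFn x).length : ℕ∞) ≤ localDepth R :=
    le_iSup₂_of_le (f := fun (rs : List R) _ => (rs.length : ℕ∞)) (List.ofFn x)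
      ⟨hmem, .of_isWeaklyRegular_of_mem_maximalIdeal R hmem hreg.isWeaklyRegular_ofFn⟩ le_rfl
  rw [List.length_ofFn] at hle
  exact localDepth_le_ringKrullDim.antisymm (hx.1 ▸ WithBot.coe_le_coe.mpr hle)

end CohenMacaulay

/-! ### Dimension at most one -/

section SmallDimension

variable {R : Type*} [CommRing R]

theorem colength_span_singleton_pow {y : R} (hreg : IsSMulRegular R y)
    (hfin : ∀ n, IsFiniteLength R (R ⧸ Ideal.span {y ^ n})) (n : ℕ) :
    colength (Ideal.span {y ^ n}) = n * colength (Ideal.span {y}) := by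
  induction n with
  | zero => simp [colength_top]
  | succ n ih =>
    have hcolon : (⊥ : Ideal R).colon {y ^ n} = ⊥ :=
      eq_bot_iff.mpr fun a ha => (hreg.pow n).right_eq_zero_of_smul
        ((mul_comm _ a).trans (mem_colon_singleton_iff_mul_mem.mp ha))
    have h := colength_sup_span_pow_succ (I := ⊥) (y := y)
      (fun n => by rw [bot_sup_eq]; exact hfin n) n
    rw [hcolon, bot_sup_eq, bot_sup_eq, bot_sup_eq, ih] at h
    rw [h]
    push_cast
    ring

theorem limitClosure_eq_span_range_of_isSMulRegular {x : Fin 1 → R}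
    (hreg : IsSMulRegular R (x 0)) : limitClosure x = Ideal.span (Set.range x) := by
  refine le_antisymm ?_ (span_range_le_limitClosure x)
  rintro a ⟨n, hn⟩
  rw [Set.range_unique, Fin.prod_univ_one, Ideal.mem_span_singleton] at hn
  rw [Set.range_unique, Ideal.mem_span_singleton]
  obtain ⟨b, hb⟩ := hn
  have hb' : a * x 0 ^ n = x 0 ^ (n + 1) * b := hb
  exact ⟨b, hreg.pow n (show x 0 ^ n * a = x 0 ^ n * (x 0 * b) by linear_combination hb')⟩

variable [IsLocalRing R] [IsNoetherianRing R]

namespace IsSystemOfParameters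

theorem hilbertCoeff_sub_colength_limitClosure_of_dim_zero {x : Fin 0 → R}
    (hx : IsSystemOfParameters x) :
    hilbertCoeff (Ideal.span (Set.range x)) 0 - colength (limitClosure x) +
      hilbertCoeff (Ideal.span (Set.range x)) 1 = 0 := by
  have hQ : Ideal.span (Set.range x) = ⊥ := by simp
  have hlim : limitClosure x = ⊥ := eq_bot_iff.mpr fun a ⟨n, hn⟩ => by simpa using hn
  obtain ⟨d, hd, hzero, -⟩ := hx.isHilbertCoeffs
  obtain rfl : 0 = d := by exact_mod_cast hx.1.symm.trans hd
  obtain ⟨n, hn⟩ := hx.eventually_colength_pow_eq.exists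
  rw [hQ, Ideal.bot_pow n.succ_ne_zero] at hn
  rw [hzero 1 one_pos, hlim, hQ, hn]
  simp

theorem hilbertCoeff_of_dim_one {x : Fin 1 → R} (hx : IsSystemOfParameters x)
    (hreg : IsSMulRegular R (x 0)) :
    hilbertCoeff (Ideal.span (Set.range x)) 0 = colength (Ideal.span (Set.range x)) ∧
      hilbertCoeff (Ideal.span (Set.range x)) 1 = 0 := by
  have hpow : ∀ n, Ideal.span (Set.range x) ^ n = Ideal.span {x 0 ^ n} := fun n => by
    rw [Set.range_unique, Ideal.span_singleton_pow]; rfl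
  have hlen : ∀ n : ℕ, colength (Ideal.span (Set.range x) ^ n) =
      n * colength (Ideal.span (Set.range x)) := fun n => by
    rw [← pow_one (Ideal.span (Set.range x)), ← pow_mul, one_mul, hpow, hpow, pow_one]
    exact colength_span_singleton_pow hreg (fun n => hpow n ▸ hx.isFiniteLength_quotient_pow n) n
  obtain ⟨n, hn⟩ := Filter.eventually_atTop.mp hx.eventually_colength_pow_eq
  have h1 := hn n le_rfl
  have h2 := hn (n + 1) n.le_succ
  simp only [hlen, Finset.sum_range_succ, Finset.range_zero, Finset.sum_empty, zero_add, pow_zero,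
    one_mul, Nat.sub_zero, Nat.choose_one_right, pow_one, Nat.sub_self, Nat.choose_zero_right,
    Nat.cast_one, mul_one] at h1 h2
  push_cast at h1 h2
  have h0 : hilbertCoeff (Ideal.span (Set.range x)) 0 = colength (Ideal.span (Set.range x)) := by
    linear_combination h1 - h2
  exact ⟨h0, by linear_combination h1 + (n + 1) * h0⟩

theorem hilbertCoeff_sub_colength_limitClosure_of_dim_one {x : Fin 1 → R}
    (hx : IsSystemOfParameters x) (hreg : IsSMulRegular R (x 0)) :
    hilbertCoeff (Ideal.span (Set.range x)) 0 - colength (limitClosure x) +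
      hilbertCoeff (Ideal.span (Set.range x)) 1 = 0 := by
  obtain ⟨h0, h1⟩ := hx.hilbertCoeff_of_dim_one hreg
  rw [h0, h1, limitClosure_eq_span_range_of_isSMulRegular hreg, sub_self, add_zero]

end IsSystemOfParameters

end SmallDimension

/-! ### Serre's condition -/

section Serre

open RingTheory.Sequence

theorem localDepth_le_of_ringEquiv {R S : Type*} [CommRing R] [IsLocalRing R] [CommRing S]
    [IsLocalRing S] (e : R ≃+* S) : localDepth R ≤ localDepth S := by
  refine iSup₂_le fun rs ⟨hmem, hreg⟩ => ?_
  have hregS : IsRegular S (rs.map e) :=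
    (AddEquiv.isRegular_congr (e := e.toAddEquiv)
      (List.forall₂_map_right_iff.mpr (List.forall₂_same.mpr fun r _ x => map_mul e r x))).mp hreg
  refine le_iSup₂_of_le (f := fun (rs : List S) _ => (rs.length : ℕ∞)) (rs.map e) ⟨?_, hregS⟩ ?_
  · simpa using hmem
  · simp

theorem SatisfiesSerreS.min_ringKrullDim_le_localDepth {R : Type*} [CommRing R] [IsLocalRing R]
    {k : ℕ} (h : SatisfiesSerreS R k) :
    min (k : WithBot ℕ∞) (ringKrullDim R) ≤ (localDepth R : WithBot ℕ∞) := by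
  have e : R ≃+* Localization.AtPrime (IsLocalRing.maximalIdeal R) :=
    (IsLocalization.atUnits R (IsLocalRing.maximalIdeal R).primeCompl fun a ha => by
      simpa [IsUnit.mem_submonoid_iff, Ideal.mem_primeCompl_iff] using ha).toRingEquiv
  rw [ringKrullDim_eq_of_ringEquiv e]
  exact (h _).trans (WithBot.coe_le_coe.mpr (localDepth_le_of_ringEquiv e.symm))

end Serre

theorem lemma3p3_general (R : Type*) [CommRing R] [IsLocalRing R] [IsNoetherianRing R]
    (hB : IsBuchsbaum R)
    (hdepth : min (2 : WithBot ℕ∞) (ringKrullDim R) ≤ (localDepth R : WithBot ℕ∞)) :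
    (∀ (d : ℕ) (x : Fin d → R) (Q : Ideal R), IsSystemOfParameters x →
      Q = Ideal.span (Set.range x) →
        0 ≤ hilbertCoeff Q 0 - lengthInt R (R ⧸ limitClosure x) + hilbertCoeff Q 1) ∧
    ((∃ (d : ℕ) (x : Fin d → R) (Q : Ideal R), IsSystemOfParameters x ∧
      Q = Ideal.span (Set.range x) ∧
        hilbertCoeff Q 0 - lengthInt R (R ⧸ limitClosure x) + hilbertCoeff Q 1 = 0) →
      IsCohenMacaulayLocal R) := by
  have hone (h : 1 ≤ ringKrullDim R) : 1 ≤ localDepth R := by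
    exact_mod_cast (le_min one_le_two h).trans hdepth
  have htwo (h : 2 ≤ ringKrullDim R) : 2 ≤ localDepth R :=
    WithBot.coe_le_coe.mp ((le_min le_rfl h).trans hdepth)
  refine ⟨?_, ?_⟩
  · rintro (_ | _ | D) x _ hx rfl
    · exact hx.hilbertCoeff_sub_colength_limitClosure_of_dim_zero.ge
    · exact (hx.hilbertCoeff_sub_colength_limitClosure_of_dim_one
        (hB.isSMulRegular hx (hone hx.1.ge) 0)).ge
    · linarith [hB.colength_limitClosure_le hx]
  · rintro ⟨_ | _ | D, x, _, hx, rfl, heq⟩ <;> refine hx.isCohenMacaulayLocal ?_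
    · exact fun _ _ i => i.elim0
    · exact hB.isRegularModFewer_one hx (hone hx.1.ge)
    · refine hB.isRegularModFewer hx (fun i j hij => hB.limitClosure_le_colonSup_sup hx ?_ hij)
        (hB.isRegularModFewer_two hx (htwo ?_)) _
      · linear_combination heq
      · exact hx.1 ▸ Nat.cast_le.mpr (Nat.le_add_left 2 D)

theorem lemma3p3 (R : Type*) [CommRing R] [IsLocalRing R] [IsNoetherianRing R]
    (hB : IsBuchsbaum R) (hS2 : SatisfiesSerreS R 2) :
    (∀ (d : ℕ) (x : Fin d → R) (Q : Ideal R), IsSystemOfParameters x →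
      Q = Ideal.span (Set.range x) →
        0 ≤ hilbertCoeff Q 0 - lengthInt R (R ⧸ limitClosure x) + hilbertCoeff Q 1) ∧
    ((∃ (d : ℕ) (x : Fin d → R) (Q : Ideal R), IsSystemOfParameters x ∧
      Q = Ideal.span (Set.range x) ∧
        hilbertCoeff Q 0 - lengthInt R (R ⧸ limitClosure x) + hilbertCoeff Q 1 = 0) →
      IsCohenMacaulayLocal R) :=
  lemma3p3_general R hB hS2.min_ringKrullDim_le_localDepth
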